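/- Let $K$ be a field and let $f,g\in K[z]$ with $n=\deg f\ge 1$ and $g\neq 0$. Assume that $K$ has characteristic $0$ or, more generally, that the characteristic of $K$ does not divide $\gcd(\deg f,\deg g)$. For nonzero $h\in K(z)$ let $\deg h$ be the degree of its numerator minus the degree of its denominator. Let $\Pi(f,g)\subset\mathbb{Z}_{\ge 0}$ be the semigroup of degrees of the nonzero elements of the subalgebra $K[f,g]$. Consider the following algorithm. Put $g_0=g$. When nonzero $g_0,\dots,g_i\in K(z)$ are constructed, put $m_j=\deg g_j$, $d_{-1}=n$, $d_j=\gcd(n,m_0,\dots,m_j)$ and $a_j=d_{j-1}/d_j$ for $0\le j\le i$. A monomial $f^{k}g_0^{j_0}\cdots g_i^{j_i}$ with $k\in\mathbb{Z}$ and $0\le j_l<a_l$ is called $i$-standard (the $(-1)$-standard monomials are the powers $f^k$, $k\in\mathbb Z$). Starting with $h=g_i^{a_i}$, subtract from $h$ a constant multiple of an $(i-1)$-standard monomial of degree $a_im_i$ so that the degree drops or the result is zero. Then, as long as the current element $h$ is nonzero and $\deg h$ is divisible by $d_i$, subtract from $h$ a constant multiple of an $i$-standard monomial of degree $\deg h$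 so that the degree drops or the result is zero. If after finitely many reductions a nonzero element of degree not divisible by $d_i$ is obtained, call it $g_{i+1}$ and repeat; if zero is obtained, put $s=i$, $g_{s+1}=0$ and stop. Suppose that $1\in\Pi(f,g)$. Then the algorithm can be carried out and stops after finitely many steps, and for the resulting degrees $m_0,\dots,m_s$ all ratios $m_i/m_{i+1}$, $i=0,1,\dots,s-1$, are (defined and) integers, and at least one of $n/m_0$, $m_0/n$ is (defined and) an integer. (Such a degree sequence $n,m_0,\dots,m_s$ is called $1$-admissible.) -/

import Mathlib

open Polynomial

noncomputable section

/-- The degree semigroup of the pair `(f, g)`: the set of degrees of the nonzero elements of the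
subalgebra `K[f, g]` of `K[z]`. -/
def degreeSemigroup {K : Type*} [Field K] (f g : K[X]) : AddSubmonoid ℕ where
  carrier := {d | ∃ h ∈ Algebra.adjoin K ({f, g} : Set K[X]), h ≠ 0 ∧ h.natDegree = d}
  zero_mem' := ⟨1, one_mem _, one_ne_zero, natDegree_one⟩
  add_mem' := by
    rintro a b ⟨h, hh, h0, rfl⟩ ⟨k, hk, k0, rfl⟩
    exact ⟨h * k, mul_mem hh hk, mul_ne_zero h0 k0, natDegree_mul h0 k0⟩

/-- The successive greatest common divisors, with the index shifted by one:
`gcdSeq n m 0 = n` (that is `d₋₁`) and `gcdSeq n m (i + 1) = gcd (n, m₀, …, mᵢ)` (that is `dᵢ`). -/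
def gcdSeq (n : ℕ) (m : ℕ → ℤ) : ℕ → ℕ
  | 0 => n
  | i + 1 => Int.gcd (gcdSeq n m i) (m i)

/-- `aᵢ = dᵢ₋₁ / dᵢ` (an exact division). -/
def expSeq (n : ℕ) (m : ℕ → ℤ) (i : ℕ) : ℕ :=
  gcdSeq n m i / gcdSeq n m (i + 1)

/-- The degrees `mᵢ = deg gᵢ` of a sequence of rational functions, where the degree of a nonzero
rational function is the degree of its numerator minus the degree of its denominator. -/
def degSeq {K : Type*} [Field K] (G : ℕ → RatFunc K) (i : ℕ) : ℤ :=
  (G i).intDegree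

/-- `M` is a monomial `f ^ k * g₀ ^ j₀ * ⋯ * gₜ₋₁ ^ jₜ₋₁` in the first `t` members of the sequence,
with `k` an integer and `0 ≤ jᵢ < aᵢ`. So the `s`-standard monomials are those with `t = s + 1`,
and for `t = 0` one gets the powers of `f`. -/
def IsStandardMonomial {K : Type*} [Field K] (f : K[X]) (G : ℕ → RatFunc K) (t : ℕ)
    (M : RatFunc K) : Prop :=
  ∃ (k : ℤ) (j : ℕ → ℕ), (∀ i < t, j i < expSeq f.natDegree (degSeq G) i) ∧
    M = (algebraMap K[X] (RatFunc K) f) ^ k * ∏ i ∈ Finset.range t, G i ^ j i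

/-- One degree reduction: `h' = h - c M`, where `M` is a standard monomial (in the first `t` members
of the sequence) of the same degree as `h ≠ 0`, the constant `c` being such that `h'` has smaller
degree than `h` or vanishes. -/
def Reduces {K : Type*} [Field K] (f : K[X]) (G : ℕ → RatFunc K) (t : ℕ)
    (h h' : RatFunc K) : Prop :=
  h ≠ 0 ∧ ∃ (c : K) (M : RatFunc K), IsStandardMonomial f G t M ∧
    M.intDegree = h.intDegree ∧ h' = h - RatFunc.C c * M ∧
    (h' = 0 ∨ h'.intDegree < h.intDegree)

/-- `G 0, …, G (s + 1)` is what the algorithm produces from the pair `(f, g)`: it starts with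
`g₀ = g`; for `i ≤ s` the element `gᵢ₊₁` comes from `gᵢ ^ aᵢ` by one reduction by an
`(i - 1)`-standard monomial and then finitely many reductions by `i`-standard monomials; for `i < s`
the `i`-th step ends with a nonzero element whose degree is not divisible by `dᵢ`, and
the `s`-th step ends with zero. Values of `G` beyond `s + 1` are irrelevant. -/
structure IsAlgorithmOutput {K : Type*} [Field K] (f g : K[X]) (s : ℕ)
    (G : ℕ → RatFunc K) : Prop where
  start : G 0 = algebraMap K[X] (RatFunc K) g
  ne_zero : ∀ i ≤ s, G i ≠ 0
  step : ∀ i ≤ s, ∃ h : RatFunc K,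
    Reduces f G i (G i ^ expSeq f.natDegree (degSeq G) i) h ∧
      Relation.ReflTransGen (Reduces f G (i + 1)) h (G (i + 1))
  not_dvd : ∀ i < s, ¬ ((gcdSeq f.natDegree (degSeq G) (i + 1) : ℤ) ∣ degSeq G (i + 1))
  terminates : G (s + 1) = 0

end

/-! Every `G i` is the value at `g` of a monic polynomial over `K[f, f⁻¹]` of degree `Nᵢ = a₀ ⋯
aᵢ₋₁`. In an expansion in powers of that polynomial the terms have degrees in different classes
modulo `dᵢ₋₁`, so leading terms never cancel. By induction, nonzero polynomials of degree below `Nᵢ`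
have nonzero values, of degree divisible by `dᵢ₋₁` (`IsKeyPolynomial.expansion`,
`dvdDegrees_and_boundsTopCoeff`).

Termination: each step with nonzero result strictly lowers the gcd. While the gcd `d` exceeds 1, the
reductions of one step must stop. Otherwise monic polynomials of the given degree would have values
of arbitrarily low degree, and dividing an element of degree 1 by one of them would leave a
remainder of degree 1, not divisible by `d` (`BoundsTopCoeff.bounded_below`). This needs quotients
bounded uniformly in the divisor, which is the role of `BoundsTopCoeff`. Once the gcd is 1, the
monic lift has degree `n`; subtracting a monic relation of degree `n` for `g` over `K[f]` shows that
its value is a combination of standard monomials, which reduces to zero.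

Divisibility: the lifts have powers of `f` in denominators. Successive approximate roots of the
monic relation are polynomials in `f` and `g` with values of the same degrees `mᵢ`; the hypothesis
on the characteristic makes the `aᵢ` with `i ≥ 1` invertible. So `mᵢ ≥ 0`, and an element of degree
`dᵢ` expands to give `dᵢ = deg v + j mᵢ` with `deg v ≥ 0`. As `dᵢ ∣ mᵢ`, either `mᵢ = dᵢ` or `dᵢ₋₁ ∣
mᵢ` (`degSeq_eq_gcdSeq_or_dvd`). For `i ≥ 1` the algorithm excludes the second case, so `mᵢ₊₁ = dᵢ₊₁
∣ dᵢ ∣ mᵢ`; for `i = 0` the two cases are the two divisibilities between `n` and `m₀`. -/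

/-! ### Degree bounds for rational functions. -/

/-- `x` vanishes or has degree at most `D`. -/
def DegLE {K : Type*} [Field K] (x : RatFunc K) (D : ℤ) : Prop :=
  x = 0 ∨ x.intDegree ≤ D

section DegLE

variable {K : Type*} [Field K] {x y : RatFunc K} {D E : ℤ}

theorem DegLE.mono (h : DegLE x D) (hDE : D ≤ E) : DegLE x E :=
  h.imp_right fun h => h.trans hDE

theorem DegLE.zero : DegLE (0 : RatFunc K) D := Or.inl rfl

theorem DegLE.of_le (h : x.intDegree ≤ D) : DegLE x D := Or.inr h

theorem DegLE.le (h : DegLE x D) (hx : x ≠ 0) : x.intDegree ≤ D := h.resolve_left hx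

theorem DegLE.add (hx : DegLE x D) (hy : DegLE y D) : DegLE (x + y) D := by
  by_cases hx0 : x = 0
  · simpa [hx0] using hy
  by_cases hy0 : y = 0
  · simpa [hy0] using hx
  by_cases hxy : x + y = 0
  · exact Or.inl hxy
  · exact Or.inr ((RatFunc.intDegree_add_le hy0 hxy).trans (max_le (hx.le hx0) (hy.le hy0)))

theorem DegLE.neg (hx : DegLE x D) : DegLE (-x) D := by
  rcases hx with rfl | hx
  · simpa using DegLE.zero
  · exact Or.inr (by rwa [RatFunc.intDegree_neg])

theorem DegLE.sub (hx : DegLE x D) (hy : DegLE y D) : DegLE (x - y) D := by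
  rw [sub_eq_add_neg]
  exact hx.add hy.neg

theorem DegLE.mul (hx : DegLE x D) (hy : DegLE y E) : DegLE (x * y) (D + E) := by
  by_cases hx0 : x = 0
  · simpa [hx0] using DegLE.zero
  by_cases hy0 : y = 0
  · simpa [hy0] using DegLE.zero
  · refine Or.inr ?_
    rw [RatFunc.intDegree_mul hx0 hy0]
    exact add_le_add (hx.le hx0) (hy.le hy0)

theorem intDegree_pow (hx : x ≠ 0) (k : ℕ) : (x ^ k).intDegree = k * x.intDegree := by
  induction k with
  | zero => simp
  | succ k ih =>
    rw [pow_succ, RatFunc.intDegree_mul (pow_ne_zero _ hx) hx, ih]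
    push_cast
    ring

theorem intDegree_zpow (hx : x ≠ 0) (k : ℤ) : (x ^ k).intDegree = k * x.intDegree := by
  cases k with
  | ofNat k => simpa using intDegree_pow hx k
  | negSucc k =>
    rw [zpow_negSucc, RatFunc.intDegree_inv, intDegree_pow hx, Int.negSucc_eq]
    push_cast
    ring

theorem DegLE.pow (hx : DegLE x D) (k : ℕ) : DegLE (x ^ k) (k * D) := by
  induction k with
  | zero => exact Or.inr (by simp)
  | succ k ih =>
    rw [pow_succ]
    exact (ih.mul hx).mono (by push_cast; linarith)

theorem intDegree_add_of_degLE (hx : x ≠ 0) (hy : DegLE y (x.intDegree - 1)) :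
    x + y ≠ 0 ∧ (x + y).intDegree = x.intDegree := by
  have hxy : x + y ≠ 0 := by
    intro h
    have h1 : y = -x := (neg_eq_of_add_eq_zero_right h).symm
    subst h1
    have := hy.le (neg_ne_zero.2 hx)
    rw [RatFunc.intDegree_neg] at this
    omega
  refine ⟨hxy, le_antisymm ?_ ?_⟩
  · exact (DegLE.add (DegLE.of_le le_rfl) (hy.mono (by omega))).le hxy
  · by_contra! hlt
    have h1 : DegLE (x + y - y) (x.intDegree - 1) := DegLE.sub (Or.inr (by omega)) hy
    rw [add_sub_cancel_right] at h1
    have := h1.le hx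
    omega

theorem intDegree_add_of_ne (hx : x ≠ 0) (hy : y ≠ 0) (hne : x.intDegree ≠ y.intDegree) :
    x + y ≠ 0 ∧ (x + y).intDegree = max x.intDegree y.intDegree := by
  rcases lt_or_gt_of_ne hne with h | h
  · rw [add_comm, max_eq_right h.le]
    exact intDegree_add_of_degLE hy (Or.inr (by omega))
  · rw [max_eq_left h.le]
    exact intDegree_add_of_degLE hx (Or.inr (by omega))

end DegLE

/-! ### Polynomials of bounded degree and division by monic polynomials. -/

section DegreeLT

variable {B : Type*} [CommRing B]

theorem mem_degreeLT_of_natDegree_lt {u : B[X]} {N : ℕ} (h : u.natDegree < N) :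
    u ∈ degreeLT B N := by
  rw [mem_degreeLT]
  by_cases hu : u = 0
  · simp [hu]
  · exact (natDegree_lt_iff_degree_lt hu).1 h

theorem natDegree_lt_of_mem_degreeLT {u : B[X]} {N : ℕ} (hN : 0 < N) (h : u ∈ degreeLT B N) :
    u.natDegree < N := by
  by_cases hu : u = 0
  · simpa [hu]
  · exact (natDegree_lt_iff_degree_lt hu).2 (mem_degreeLT.1 h)

theorem mul_mem_degreeLT {u v : B[X]} {M N : ℕ} (hu : u ∈ degreeLT B N) (hv : v.natDegree ≤ M) :
    u * v ∈ degreeLT B (N + M) := by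
  rcases Nat.eq_zero_or_pos N with rfl | hN
  · have : u = 0 := by
      have := mem_degreeLT.1 hu
      simpa using this
    simp [this]
  · have := natDegree_lt_of_mem_degreeLT hN hu
    exact mem_degreeLT_of_natDegree_lt (by have := natDegree_mul_le (p := u) (q := v); omega)

variable [Nontrivial B]

theorem modByMonic_mem_degreeLT {u p : B[X]} (hp : p.Monic) :
    u %ₘ p ∈ degreeLT B p.natDegree := by
  rw [mem_degreeLT, ← degree_eq_natDegree hp.ne_zero]
  exact degree_modByMonic_lt _ hp

theorem divByMonic_mem_degreeLT {u p : B[X]} {M N : ℕ} (hp : p.Monic) (hN : p.natDegree = N)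
    (hu : u ∈ degreeLT B (M + N)) : u /ₘ p ∈ degreeLT B M := by
  rcases Nat.eq_zero_or_pos M with rfl | hM
  · have : u /ₘ p = 0 := by
      rw [divByMonic_eq_zero_iff hp, degree_eq_natDegree hp.ne_zero, hN]
      simpa using mem_degreeLT.1 hu
    rw [this]
    exact zero_mem _
  · refine mem_degreeLT_of_natDegree_lt ?_
    have := natDegree_lt_of_mem_degreeLT (by omega) hu
    rw [natDegree_divByMonic _ hp]
    omega

theorem sub_mem_degreeLT_of_monic {p q : B[X]} {N : ℕ} (hp : p.Monic) (hq : q.Monic)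
    (hpN : p.natDegree = N) (hqN : q.natDegree = N) : p - q ∈ degreeLT B N := by
  rw [mem_degreeLT, ← hpN, ← degree_eq_natDegree hp.ne_zero]
  refine degree_sub_lt_left ?_ hp.ne_zero (by rw [hp.leadingCoeff, hq.leadingCoeff])
  rw [degree_eq_natDegree hp.ne_zero, degree_eq_natDegree hq.ne_zero, hpN, hqN]

theorem monic_add_of_mem_degreeLT {p u : B[X]} {N : ℕ} (hp : p.Monic) (hpN : p.natDegree = N)
    (hu : u ∈ degreeLT B N) : (p + u).Monic ∧ (p + u).natDegree = N := by
  have h : u.degree < p.degree := by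
    rw [degree_eq_natDegree hp.ne_zero, hpN]
    exact mem_degreeLT.1 hu
  exact ⟨hp.add_of_left h, by rw [natDegree_add_eq_left_of_degree_lt h, hpN]⟩

end DegreeLT

/-! ### Expansions in powers of a key polynomial and degrees of values. -/

section Expansion

variable {K : Type*} [Field K] {B : Type*} [CommRing B]

/-- Nonzero polynomials of degree less than `N` are not killed by `ev`, and their values have
degrees divisible by `d`. -/
def DvdDegrees (ev : B[X] →+* RatFunc K) (N d : ℕ) : Prop :=
  ∀ u ∈ degreeLT B N, u ≠ 0 → ev u ≠ 0 ∧ (d : ℤ) ∣ (ev u).intDegree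

/-- The setting of `ψ`-adic expansions with at most `a` terms: `ψ` is monic of degree `N`, values of
polynomials of smaller degree have degrees divisible by `d`, and the multiples
`0, m, …, (a - 1) m` of the degree `m` of the value of `ψ` are distinct modulo `d`. -/
structure IsKeyPolynomial (ev : B[X] →+* RatFunc K) (N d a : ℕ) (ψ : B[X]) : Prop where
  dvdDegrees : DvdDegrees ev N d
  monic : ψ.Monic
  natDegree_eq : ψ.natDegree = N
  ne_zero : ev ψ ≠ 0
  not_dvd : ∀ j : ℕ, 0 < j → j < a → ¬ (d : ℤ) ∣ j * (ev ψ).intDegree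

variable {ev : B[X] →+* RatFunc K} {N d a : ℕ} {ψ : B[X]}

/-- The degree of the coefficient of `X ^ (N - 1)` is bounded in terms of the degree of the value,
for polynomials of degree less than `N`. -/
def BoundsTopCoeff (ev : B[X] →+* RatFunc K) (N : ℕ) : Prop :=
  ∃ E : ℤ, ∀ u ∈ degreeLT B N, u.coeff (N - 1) ≠ 0 →
    (ev (C (u.coeff (N - 1)))).intDegree + E ≤ (ev u).intDegree

theorem boundsTopCoeff_one : BoundsTopCoeff ev 1 := by
  refine ⟨0, fun u hu _ => ?_⟩
  have hu1 : u.natDegree = 0 := by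
    have := natDegree_lt_of_mem_degreeLT one_pos hu
    omega
  rw [eq_C_of_natDegree_eq_zero hu1]
  simp

namespace IsKeyPolynomial

theorem degrees_ne (h : IsKeyPolynomial ev N d a ψ) {x y : ℤ} {i j : ℕ} (hx : (d : ℤ) ∣ x)
    (hy : (d : ℤ) ∣ y) (hij : j < i) (hi : i < a) :
    x + i * (ev ψ).intDegree ≠ y + j * (ev ψ).intDegree := by
  intro heq
  refine h.not_dvd (i - j) (by omega) (by omega) ?_
  have : ((i - j : ℕ) : ℤ) * (ev ψ).intDegree = y - x := by
    rw [Nat.cast_sub hij.le]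
    linear_combination heq
  rw [this]
  exact dvd_sub hy hx

theorem ev_mul_pow (h : IsKeyPolynomial ev N d a ψ) {α : B[X]} (hα : α ∈ degreeLT B N)
    (hα0 : α ≠ 0) (k : ℕ) : ev (α * ψ ^ k) ≠ 0 ∧
      (ev (α * ψ ^ k)).intDegree = (ev α).intDegree + k * (ev ψ).intDegree := by
  obtain ⟨h1, -⟩ := h.dvdDegrees α hα hα0
  have h2 := pow_ne_zero k h.ne_zero
  rw [map_mul, map_pow, RatFunc.intDegree_mul h1 h2, intDegree_pow h.ne_zero]
  exact ⟨mul_ne_zero h1 h2, rfl⟩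

variable [Nontrivial B]

/-- Division by a power of a key polynomial. -/
theorem exists_eq_add (h : IsKeyPolynomial ev N d a ψ) {k : ℕ} {u : B[X]}
    (hu : u ∈ degreeLT B ((k + 1) * N)) :
    ∃ α ∈ degreeLT B N, ∃ r ∈ degreeLT B (k * N), u = α * ψ ^ k + r := by
  have hmk : (ψ ^ k).Monic := h.monic.pow k
  have hdk : (ψ ^ k).natDegree = k * N := by rw [h.monic.natDegree_pow, h.natDegree_eq]
  refine ⟨u /ₘ ψ ^ k, divByMonic_mem_degreeLT hmk hdk ?_, u %ₘ ψ ^ k, ?_, ?_⟩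
  · convert hu using 2
    ring
  · rw [← hdk]
    exact modByMonic_mem_degreeLT hmk
  · rw [mul_comm, add_comm, modByMonic_add_div]

/-- No cancellation of leading terms in the values of expansions with at most `a` terms. -/
theorem expansion (h : IsKeyPolynomial ev N d a ψ) {k : ℕ} (hk : k ≤ a) {u : B[X]}
    (hu : u ∈ degreeLT B (k * N)) (hu0 : u ≠ 0) :
    ev u ≠ 0 ∧ ∃ j < k, ∃ v ∈ degreeLT B N, v ≠ 0 ∧
      (ev u).intDegree = (ev v).intDegree + j * (ev ψ).intDegree := by
  induction k generalizing u with
  | zero =>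
    rw [zero_mul, mem_degreeLT] at hu
    exact absurd (by simpa using hu) hu0
  | succ k ih =>
    obtain ⟨α, hα, r, hr, rfl⟩ := h.exists_eq_add hu
    by_cases hα0 : α = 0
    · subst hα0
      simp only [zero_mul, zero_add] at hu0 ⊢
      obtain ⟨h1, j, hj, hv⟩ := ih (by omega) hr hu0
      exact ⟨h1, j, by omega, hv⟩
    obtain ⟨h1, h2⟩ := h.ev_mul_pow hα hα0 k
    by_cases hr0 : r = 0
    · subst hr0
      rw [add_zero]
      exact ⟨h1, k, by omega, α, hα, hα0, h2⟩
    obtain ⟨h3, j, hj, v, hv, hv0, h4⟩ := ih (by omega) hr hr0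
    have hne : (ev (α * ψ ^ k)).intDegree ≠ (ev r).intDegree := by
      rw [h2, h4]
      exact h.degrees_ne (h.dvdDegrees α hα hα0).2 (h.dvdDegrees v hv hv0).2 hj (by omega)
    rw [map_add]
    obtain ⟨h5, h6⟩ := intDegree_add_of_ne h1 h3 hne
    refine ⟨h5, ?_⟩
    rcases max_choice (ev (α * ψ ^ k)).intDegree (ev r).intDegree with h7 | h7
    · exact ⟨k, by omega, α, hα, hα0, by rw [h6, h7, h2]⟩
    · exact ⟨j, by omega, v, hv, hv0, by rw [h6, h7, h4]⟩

/-- The degree of the value of the leading term of an expansion is at most that of the sum. -/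
theorem leading_le (h : IsKeyPolynomial ev N d a ψ) {k : ℕ} (hk : k < a) {α r : B[X]}
    (hα : α ∈ degreeLT B N) (hα0 : α ≠ 0) (hr : r ∈ degreeLT B (k * N)) :
    ev (α * ψ ^ k + r) ≠ 0 ∧
      (ev α).intDegree + k * (ev ψ).intDegree ≤ (ev (α * ψ ^ k + r)).intDegree := by
  obtain ⟨h1, h2⟩ := h.ev_mul_pow hα hα0 k
  by_cases hr0 : r = 0
  · subst hr0
    rw [add_zero]
    exact ⟨h1, h2.ge⟩
  obtain ⟨h3, j, hj, v, hv, hv0, h4⟩ := h.expansion hk.le hr hr0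
  have hne : (ev (α * ψ ^ k)).intDegree ≠ (ev r).intDegree := by
    rw [h2, h4]
    exact h.degrees_ne (h.dvdDegrees α hα hα0).2 (h.dvdDegrees v hv hv0).2 hj hk
  rw [map_add]
  obtain ⟨h5, h6⟩ := intDegree_add_of_ne h1 h3 hne
  exact ⟨h5, by rw [h6, ← h2]; exact le_max_left _ _⟩

/-- Inductive step of the divisibility statement: without cancellation the degree is that of a
single term, a multiple of `d` plus a multiple of the degree of `ev ψ`. -/
theorem dvdDegrees_mul (h : IsKeyPolynomial ev N d a ψ) :
    DvdDegrees ev (a * N) (Int.gcd d (ev ψ).intDegree) := by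
  intro u hu hu0
  obtain ⟨h1, j, hj, v, hv, hv0, h2⟩ := h.expansion le_rfl hu hu0
  refine ⟨h1, ?_⟩
  rw [h2]
  exact dvd_add ((Int.gcd_dvd_left ..).trans (h.dvdDegrees v hv hv0).2)
    ((Int.gcd_dvd_right ..).mul_left _)

end IsKeyPolynomial

/-- Division by monic polynomials of degree `N` whose values have bounded degrees: the degrees of
the values of the quotients and remainders are bounded. -/
theorem BoundsTopCoeff.bounded_division (ht : BoundsTopCoeff ev N) (hN : 0 < N)
    (hd : DvdDegrees ev N d) (D : ℤ) (u : B[X]) :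
    ∃ C : ℤ, ∀ Ψ : B[X], Ψ.Monic → Ψ.natDegree = N → DegLE (ev Ψ) D →
      ∃ q, ∃ r ∈ degreeLT B N, u = q * Ψ + r ∧ DegLE (ev q) C ∧ DegLE (ev r) C := by
  obtain ⟨E, hE⟩ := ht
  have hX : ∀ n : ℕ, ∃ C : ℤ, ∀ Ψ : B[X], Ψ.Monic → Ψ.natDegree = N → DegLE (ev Ψ) D →
      ∃ q, ∃ r ∈ degreeLT B N, X ^ n = q * Ψ + r ∧ DegLE (ev q) C ∧ DegLE (ev r) C := by
    intro n
    induction n with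
    | zero =>
      refine ⟨0, fun Ψ _ _ _ => ⟨0, 1, mem_degreeLT_of_natDegree_lt (by simpa), by simp, ?_, ?_⟩⟩
      · rw [map_zero]; exact DegLE.zero
      · rw [map_one]; exact DegLE.of_le (by simp)
    | succ n ih =>
      obtain ⟨c, hc⟩ := ih
      set m := (ev X).intDegree
      refine ⟨max (max (m + c) (c - E)) (c - E + D), fun Ψ hΨ hΨN hΨD => ?_⟩
      obtain ⟨q, r, hr, hqr, hq, hr'⟩ := hc Ψ hΨ hΨN hΨD
      have hm : DegLE (ev X) m := DegLE.of_le le_rfl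
      have hb : DegLE (ev (C (r.coeff (N - 1)))) (c - E) := by
        by_cases h0 : r.coeff (N - 1) = 0
        · rw [h0]; simpa using DegLE.zero
        · have hr0 : r ≠ 0 := by
            rintro rfl
            simp at h0
          refine Or.inr ?_
          have := hE r hr h0
          have := hr'.le (hd r hr hr0).1
          linarith
      -- Multiplying by `X` can push the remainder up to degree `N`; its coefficient there is the
      -- old top coefficient, so that multiple of `Ψ` moves into the quotient.
      refine ⟨X * q + C (r.coeff (N - 1)), X * r - C (r.coeff (N - 1)) * Ψ, ?_, ?_, ?_, ?_⟩
      · rw [mem_degreeLT, degree_lt_iff_coeff_zero]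
        intro l hl
        obtain ⟨l, rfl⟩ : ∃ l', l = l' + 1 := ⟨l - 1, by omega⟩
        rw [coeff_sub, coeff_X_mul, coeff_C_mul]
        rcases Nat.eq_or_lt_of_le hl with hl | hl
        · rw [← hl, show l = N - 1 by omega]
          nth_rw 3 [← hΨN]
          rw [hΨ.coeff_natDegree, mul_one, sub_self]
        · rw [coeff_eq_zero_of_natDegree_lt (by omega : Ψ.natDegree < l + 1),
            coeff_eq_zero_of_degree_lt ((mem_degreeLT.1 hr).trans_le (by exact_mod_cast by omega))]
          simp
      · rw [pow_succ', hqr]; ring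
      · rw [map_add, map_mul]
        exact ((hm.mul hq).mono (by omega)).add (hb.mono (by omega))
      · rw [map_sub, map_mul, map_mul]
        exact ((hm.mul hr').mono (by omega)).sub ((hb.mul hΨD).mono (by omega))
  induction u using Polynomial.induction_on' with
  | add p q hp hq =>
    obtain ⟨c, hc⟩ := hp
    obtain ⟨e, he⟩ := hq
    refine ⟨max c e, fun Ψ hΨ hΨN hΨD => ?_⟩
    obtain ⟨q₁, r₁, hr₁, rfl, h1, h2⟩ := hc Ψ hΨ hΨN hΨD
    obtain ⟨q₂, r₂, hr₂, rfl, h3, h4⟩ := he Ψ hΨ hΨN hΨD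
    refine ⟨q₁ + q₂, r₁ + r₂, add_mem hr₁ hr₂, by ring, ?_, ?_⟩
    · rw [map_add]
      exact (h1.mono (le_max_left _ _)).add (h3.mono (le_max_right _ _))
    · rw [map_add]
      exact (h2.mono (le_max_left _ _)).add (h4.mono (le_max_right _ _))
  | monomial n b =>
    obtain ⟨c, hc⟩ := hX n
    refine ⟨(ev (C b)).intDegree + c, fun Ψ hΨ hΨN hΨD => ?_⟩
    obtain ⟨q, r, hr, hqr, h1, h2⟩ := hc Ψ hΨ hΨN hΨD
    refine ⟨C b * q, C b * r, ?_, ?_, ?_, ?_⟩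
    · rw [← smul_eq_C_mul]
      exact Submodule.smul_mem _ _ hr
    · rw [← C_mul_X_pow_eq_monomial, hqr]; ring
    · rw [map_mul]
      exact DegLE.mul (DegLE.of_le le_rfl) h1
    · rw [map_mul]
      exact DegLE.mul (DegLE.of_le le_rfl) h2

/-- The top coefficient of `u` is that of the leading coefficient `α` of its `ψ`-adic expansion, and
`leading_le` bounds the degree of the value of `α`. -/
theorem IsKeyPolynomial.boundsTopCoeff_mul [Nontrivial B]
    (h : IsKeyPolynomial ev N d a ψ) (hN : 0 < N)
    (ha : 0 < a) (ht : BoundsTopCoeff ev N) : BoundsTopCoeff ev (a * N) := by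
  obtain ⟨E, hE⟩ := ht
  obtain ⟨k, rfl⟩ : ∃ k, a = k + 1 := ⟨a - 1, by omega⟩
  refine ⟨E + k * (ev ψ).intDegree, fun u hu hu0 => ?_⟩
  obtain ⟨α, hα, r, hr, rfl⟩ := h.exists_eq_add hu
  have hc : (α * ψ ^ k + r).coeff ((k + 1) * N - 1) = α.coeff (N - 1) := by
    have h1 : (k + 1) * N - 1 = (N - 1) + k * N := by
      rw [Nat.succ_mul]
      omega
    have hdk : (ψ ^ k).natDegree = k * N := by rw [h.monic.natDegree_pow, h.natDegree_eq]
    have hαN := natDegree_lt_of_mem_degreeLT hN hα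
    rw [h1, coeff_add, coeff_mul_add_eq_of_natDegree_le (by omega) hdk.le, ← hdk,
      (h.monic.pow k).coeff_natDegree, mul_one, hdk,
      coeff_eq_zero_of_degree_lt ((mem_degreeLT.1 hr).trans_le (by exact_mod_cast by omega)),
      add_zero]
  rw [hc] at hu0 ⊢
  have hα0 : α ≠ 0 := by
    rintro rfl
    simp at hu0
  have h2 := (h.leading_le (Nat.lt_succ_self k) hα hα0 hr).2
  have h3 := hE α hα hu0
  linarith

/-- If some value has degree not divisible by `d`, the degrees of the values of monic polynomials of
degree `N` are bounded below. -/
theorem BoundsTopCoeff.bounded_below (ht : BoundsTopCoeff ev N) (hN : 0 < N)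
    (hd : DvdDegrees ev N d) {u : B[X]} (hu : ¬ (d : ℤ) ∣ (ev u).intDegree) (D : ℤ) :
    ∃ C : ℤ, ∀ Ψ : B[X], Ψ.Monic → Ψ.natDegree = N → DegLE (ev Ψ) D → ¬ DegLE (ev Ψ) C := by
  obtain ⟨c, hc⟩ := ht.bounded_division hN hd D u
  -- With this constant `q * Ψ` has value of degree below that of `u`, so the remainder would
  -- inherit the degree of `u`.
  refine ⟨(ev u).intDegree - 1 - c, fun Ψ hΨ hΨN hΨD hΨC => hu ?_⟩
  obtain ⟨q, r, hr, hqr, h1, -⟩ := hc Ψ hΨ hΨN hΨD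
  have h2 : DegLE (-ev (q * Ψ)) ((ev u).intDegree - 1) := by
    rw [map_mul]
    exact (h1.mul hΨC).neg.mono (by omega)
  have hu0 : ev u ≠ 0 := by
    intro h
    simp [h] at hu
  obtain ⟨h3, h4⟩ := intDegree_add_of_degLE hu0 h2
  have h5 : ev u + -ev (q * Ψ) = ev r := by
    rw [hqr, map_add]; ring
  rw [h5] at h3 h4
  rw [← h4]
  refine (hd r hr ?_).2
  rintro rfl
  simp at h3

end Expansion

/-! ### Approximate roots. -/

section ApproximateRoot

/-- The cofactor is a sum of `k + 1` monic polynomials of degree `k * N`; its top coefficient `k +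
1` is what has to be inverted later. -/
theorem exists_pow_sub_pow_eq {R : Type*} [CommRing R] {A A' : R[X]} {N : ℕ}
    (hA : A.Monic) (hA' : A'.Monic) (hN : A.natDegree = N) (hN' : A'.natDegree = N) (k : ℕ) :
    ∃ S : R[X], A' ^ (k + 1) - A ^ (k + 1) = (A' - A) * S ∧ S.natDegree ≤ k * N ∧
      S.coeff (k * N) = (k + 1 : ℕ) := by
  have key : ∀ i ∈ Finset.range (k + 1), (A' ^ i * A ^ (k + 1 - 1 - i)).Monic ∧
      (A' ^ i * A ^ (k + 1 - 1 - i)).natDegree = k * N := by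
    intro i hi
    refine ⟨(hA'.pow i).mul (hA.pow _), ?_⟩
    rw [(hA'.pow i).natDegree_mul (hA.pow _), hA.natDegree_pow, hA'.natDegree_pow, hN, hN',
      ← add_mul]
    congr 1
    have := Finset.mem_range.1 hi
    omega
  refine ⟨∑ i ∈ Finset.range (k + 1), A' ^ i * A ^ (k + 1 - 1 - i), ?_, ?_, ?_⟩
  · rw [mul_comm, geom_sum₂_mul]
  · exact natDegree_sum_le_of_forall_le _ _ fun i hi => (key i hi).2.le
  · rw [finsetSum_coeff, Finset.sum_congr rfl (g := fun _ => 1)]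
    · simp
    · intro i hi
      have := (key i hi).1.coeff_natDegree
      rwa [(key i hi).2] at this

/-- Existence of approximate roots. -/
theorem exists_approximate_root {R : Type*} [CommRing R] [Nontrivial R] {k N : ℕ}
    (hk : IsUnit ((k + 1 : ℕ) : R)) {Q : R[X]} (hQ : Q.Monic) (hQN : Q.natDegree = (k + 1) * N) :
    ∃ A : R[X], A.Monic ∧ A.natDegree = N ∧ Q - A ^ (k + 1) ∈ degreeLT R (k * N) := by
  -- The coefficients of `A` are determined from the top down; `e` counts those already adjusted.
  suffices H : ∀ e ≤ N, ∃ A : R[X], A.Monic ∧ A.natDegree = N ∧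
      Q - A ^ (k + 1) ∈ degreeLT R (k * N + (N - e)) by
    simpa using H N le_rfl
  intro e he
  induction e with
  | zero =>
    refine ⟨X ^ N, monic_X_pow N, natDegree_X_pow N, ?_⟩
    refine sub_mem_degreeLT_of_monic hQ ((monic_X_pow N).pow _) (by rw [hQN]; simp; ring) ?_
    rw [(monic_X_pow N).natDegree_pow, natDegree_X_pow]
    simp
    ring
  | succ e ih =>
    obtain ⟨A, hA, hAN, hQA⟩ := ih (by omega)
    obtain ⟨b, hb⟩ := hk.exists_right_inv
    set l := N - (e + 1) with hl
    set c := (Q - A ^ (k + 1)).coeff (k * N + l) with hc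
    -- As `b` inverts `k + 1`, this changes the coefficient of the power in degree `k * N + l` by
    -- exactly `c`.
    set t : R[X] := C (b * c) * X ^ l with ht
    have htd : t.natDegree ≤ l := natDegree_C_mul_X_pow_le _ _
    obtain ⟨hA', hAN'⟩ := monic_add_of_mem_degreeLT hA hAN
      (mem_degreeLT_of_natDegree_lt (by omega : t.natDegree < N))
    refine ⟨A + t, hA', hAN', ?_⟩
    obtain ⟨S, hS, hSd, hSc⟩ := exists_pow_sub_pow_eq hA hA' hAN hAN' k
    have h1 : Q - (A + t) ^ (k + 1) = (Q - A ^ (k + 1)) - t * S := by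
      rw [add_sub_cancel_left] at hS
      rw [← hS]; ring
    rw [mem_degreeLT, degree_lt_iff_coeff_zero, h1]
    intro i hi
    rw [coeff_sub]
    rcases Nat.eq_or_lt_of_le hi with rfl | hi
    · rw [← hc, add_comm (k * N) l, coeff_mul_add_eq_of_natDegree_le htd hSd, hSc, ht,
        coeff_C_mul, coeff_X_pow_self]
      linear_combination (-c) * hb
    · rw [coeff_eq_zero_of_degree_lt ((mem_degreeLT.1 hQA).trans_le (by exact_mod_cast by omega)),
        coeff_eq_zero_of_natDegree_lt, sub_zero]
      have := natDegree_mul_le (p := t) (q := S)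
      omega

variable {K : Type*} [Field K] {B : Type*} [CommRing B] [Nontrivial B]
variable {ev : B[X] →+* RatFunc K} {N d k : ℕ}

/-- An approximate root has a value of the same degree as a key polynomial. -/
theorem IsKeyPolynomial.intDegree_approximate_root {ψ : B[X]}
    (h : IsKeyPolynomial ev N d (k + 1) ψ) (hk0 : 0 < k)
    (hkB : IsUnit ((k + 1 : ℕ) : B)) {Q A : B[X]} (hQ : Q.Monic)
    (hQN : Q.natDegree = (k + 1) * N)
    (hQd : DegLE (ev Q) ((k + 1 : ℕ) * (ev ψ).intDegree)) (hA : A.Monic) (hAN : A.natDegree = N)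
    (hQA : Q - A ^ (k + 1) ∈ degreeLT B (k * N)) :
    ev A ≠ 0 ∧ (ev A).intDegree = (ev ψ).intDegree := by
  obtain ⟨b, hb⟩ := hkB.exists_right_inv
  have hbL : DegLE (ev (C b)) 0 := by
    have h1 : RatFunc.C ((k + 1 : ℕ) : K) * ev (C b) = 1 := by
      rw [map_natCast, ← map_natCast ev, ← map_mul, ← map_natCast C, ← C_mul, hb, C_1, map_one]
    have h2 : ev (C b) = RatFunc.C (((k + 1 : ℕ) : K)⁻¹) := by
      rw [map_inv₀]
      exact (eq_inv_of_mul_eq_one_right h1)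
    rw [h2]
    exact DegLE.of_le (RatFunc.intDegree_C _).le
  -- A key polynomial `φ` is moved towards `A`, keeping the degree of its value while `A - φ` loses
  -- degree.
  suffices H : ∀ e ≤ N, ∀ φ : B[X], IsKeyPolynomial ev N d (k + 1) φ →
      (ev φ).intDegree = (ev ψ).intDegree → A - φ ∈ degreeLT B e →
      ev A ≠ 0 ∧ (ev A).intDegree = (ev ψ).intDegree from
    H N le_rfl ψ h rfl (sub_mem_degreeLT_of_monic hA h.monic hAN h.natDegree_eq)
  intro e he
  induction e with
  | zero =>
    intro φ hφ hφd hAφ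
    have h0 : A - φ = 0 := by simpa using mem_degreeLT.1 hAφ
    rw [sub_eq_zero.1 h0]
    exact ⟨hφ.ne_zero, hφd⟩
  | succ e ih =>
    intro φ hφ hφd hAφ
    have hm : (φ ^ k).Monic := hφ.monic.pow k
    have hmN : (φ ^ k).natDegree = k * N := by rw [hφ.monic.natDegree_pow, hφ.natDegree_eq]
    obtain ⟨α, hα, r, hr, hαr⟩ := hφ.exists_eq_add (sub_mem_degreeLT_of_monic hQ
      (hφ.monic.pow (k + 1)) hQN (by rw [hφ.monic.natDegree_pow, hφ.natDegree_eq]))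
    -- The bound on `Q` gives `deg α ≤ deg φ` for the values; equality is impossible because `d`
    -- divides only the first degree. This uses `1 < k + 1`.
    have hαd : DegLE (ev α) ((ev φ).intDegree - 1) := by
      by_cases hα0 : α = 0
      · rw [hα0, map_zero]
        exact DegLE.zero
      obtain ⟨h1, h2⟩ := hφ.leading_le (Nat.lt_succ_self k) hα hα0 hr
      have h3 : DegLE (ev (Q - φ ^ (k + 1))) ((k + 1 : ℕ) * (ev φ).intDegree) := by
        rw [map_sub, map_pow]
        refine DegLE.sub (by rwa [hφd]) ((DegLE.of_le le_rfl).pow (k + 1))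
      rw [hαr] at h3
      have h4 := h2.trans (h3.le h1)
      have h5 : (ev α).intDegree ≤ (ev φ).intDegree := by
        push_cast at h4
        linarith
      refine Or.inr (Int.le_sub_one_of_lt (lt_of_le_of_ne h5 fun h6 => ?_))
      have h7 := (hφ.dvdDegrees α hα hα0).2
      rw [h6] at h7
      exact hφ.not_dvd 1 one_pos (by omega) (by simpa using h7)
    -- Compare leading terms in `A ^ (k + 1) - φ ^ (k + 1) = (A - φ) * S`: the cofactor `S` agrees
    -- with `(k + 1) φ ^ k` up to lower degree, while the left side is `α * φ ^ k` up to degree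
    -- below `k * N`.
    have hβ : ((k + 1 : ℕ) : B) • (A - φ) - α ∈ degreeLT B e := by
      obtain ⟨S, hS, hSd, hSc⟩ := exists_pow_sub_pow_eq hφ.monic hA hφ.natDegree_eq hAN k
      have h1 : S - C ((k + 1 : ℕ) : B) * φ ^ k ∈ degreeLT B (k * N) := by
        rw [mem_degreeLT, degree_lt_iff_coeff_zero]
        intro i hi
        rw [coeff_sub, coeff_C_mul]
        rcases Nat.eq_or_lt_of_le hi with rfl | hi
        · have := hm.coeff_natDegree
          rw [hmN] at this
          rw [hSc, this, mul_one, sub_self]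
        · rw [coeff_eq_zero_of_natDegree_lt (by omega), coeff_eq_zero_of_natDegree_lt (by omega)]
          simp
      have h2 : (A - φ).natDegree ≤ e := by
        have := natDegree_lt_of_mem_degreeLT (Nat.succ_pos e) hAφ
        omega
      have h3 : (((k + 1 : ℕ) : B) • (A - φ) - α) * φ ^ k ∈ degreeLT B (e + k * N) := by
        have h4 : (((k + 1 : ℕ) : B) • (A - φ) - α) * φ ^ k =
            (r - (Q - A ^ (k + 1))) - (S - C ((k + 1 : ℕ) : B) * φ ^ k) * (A - φ) := by
          rw [smul_eq_C_mul]
          linear_combination hαr - hS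
        rw [h4]
        refine sub_mem (degreeLT_mono (by omega) (sub_mem hr hQA)) ?_
        rw [add_comm]
        exact mul_mem_degreeLT h1 h2
      have h5 := divByMonic_mem_degreeLT hm hmN h3
      rwa [mul_comm, mul_divByMonic_cancel_left _ hm] at h5
    have hbα : C b * α ∈ degreeLT B N := by
      rw [← smul_eq_C_mul]
      exact Submodule.smul_mem _ _ hα
    obtain ⟨h1, h2⟩ := monic_add_of_mem_degreeLT hφ.monic hφ.natDegree_eq hbα
    have h3 : DegLE (ev (C b * α)) ((ev φ).intDegree - 1) := by
      rw [map_mul]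
      exact (hbL.mul hαd).mono (by omega)
    obtain ⟨h4, h5⟩ := intDegree_add_of_degLE hφ.ne_zero h3
    rw [← map_add] at h4 h5
    -- Tschirnhausen's substitution: replace `φ` by `φ + α / (k + 1)`.
    refine ih (by omega) (φ + C b * α) ⟨hφ.dvdDegrees, h1, h2, h4, ?_⟩ (h5.trans hφd) ?_
    · rw [h5]
      exact hφ.not_dvd
    · have h6 : A - (φ + C b * α) = b • (((k + 1 : ℕ) : B) • (A - φ) - α) := by
        rw [smul_sub, smul_smul, mul_comm b, hb, one_smul, smul_eq_C_mul]
        ring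
      rw [h6]
      exact Submodule.smul_mem _ _ hβ

end ApproximateRoot

/-! ### Evaluation at `(f, g)` and the monic relation for `g` over `K[f]`. -/

section Evaluation

variable {K : Type*} [Field K]

/-- The algebra of Laurent polynomials in `f`, as a subalgebra of the rational functions. -/
noncomputable abbrev laurentAlgebra (f : K[X]) : Subalgebra K (RatFunc K) :=
  Algebra.adjoin K {algebraMap K[X] (RatFunc K) f, (algebraMap K[X] (RatFunc K) f)⁻¹}

/-- Substitution of `g` into polynomials with coefficients in `K[f, f⁻¹]`. -/
noncomputable def laurentEval (f g : K[X]) : (laurentAlgebra f)[X] →+* RatFunc K :=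
  eval₂RingHom (laurentAlgebra f).val.toRingHom (algebraMap K[X] (RatFunc K) g)

/-- Substitution of the pair `(f, g)` into polynomials in two variables, with values in `K[z]`. -/
noncomputable def pairEval (f g : K[X]) : K[X][X] →+* K[X] :=
  eval₂RingHom (compRingHom f) g

/-- Substitution of the pair `(f, g)` into polynomials in two variables, with values in `K(z)`. -/
noncomputable def pairEvalRat (f g : K[X]) : K[X][X] →+* RatFunc K :=
  (algebraMap K[X] (RatFunc K)).comp (pairEval f g)

/-- Substitution of `f` into polynomials in one variable, with values in `K[f, f⁻¹]`. -/
noncomputable def toLaurentAlgebra (f : K[X]) : K[X] →+* laurentAlgebra f :=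
  (aeval (⟨algebraMap K[X] (RatFunc K) f,
    Algebra.subset_adjoin (Set.mem_insert _ _)⟩ : laurentAlgebra f)).toRingHom

variable {f g : K[X]}

theorem coe_toLaurentAlgebra (p : K[X]) :
    (toLaurentAlgebra f p : RatFunc K) = algebraMap K[X] (RatFunc K) (p.comp f) := by
  have h : ((laurentAlgebra f).val.toRingHom.comp (toLaurentAlgebra f)) =
      (algebraMap K[X] (RatFunc K)).comp (compRingHom f) := by
    ext x
    · simp [toLaurentAlgebra]
    · simp [toLaurentAlgebra]
  exact RingHom.congr_fun h p

theorem toLaurentAlgebra_injective (hf : 0 < f.natDegree) :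
    Function.Injective (toLaurentAlgebra f) := by
  rw [injective_iff_map_eq_zero]
  intro p hp
  have h1 := coe_toLaurentAlgebra (f := f) p
  rw [hp] at h1
  have h2 : p.comp f = 0 := by
    have h3 := h1.symm
    simpa using h3
  rcases comp_eq_zero_iff.1 h2 with h | ⟨-, h⟩
  · exact h
  · rw [h] at hf
    simp at hf

theorem laurentEval_map (u : K[X][X]) :
    laurentEval f g (u.map (toLaurentAlgebra f)) = pairEvalRat f g u := by
  have h : (laurentEval f g).comp (mapRingHom (toLaurentAlgebra f)) = pairEvalRat f g := by
    apply Polynomial.ringHom_ext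
    · intro p
      simpa [laurentEval, pairEvalRat, pairEval] using coe_toLaurentAlgebra p
    · simp [laurentEval, pairEvalRat, pairEval]
  exact RingHom.congr_fun h u

theorem laurentEval_C (b : laurentAlgebra f) : laurentEval f g (C b) = b := by
  simp [laurentEval]

theorem laurentEval_X : laurentEval f g X = algebraMap K[X] (RatFunc K) g := by
  simp [laurentEval]

theorem exists_mul_pow_eq (hf : f ≠ 0) {b : RatFunc K} (hb : b ∈ laurentAlgebra f) :
    ∃ (T : ℕ) (p : K[X]), b * algebraMap K[X] (RatFunc K) f ^ T =
      algebraMap K[X] (RatFunc K) (p.comp f) := by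
  have hfL : algebraMap K[X] (RatFunc K) f ≠ 0 := by simpa
  induction hb using Algebra.adjoin_induction with
  | mem x hx =>
    rcases hx with rfl | rfl
    · exact ⟨0, X, by simp⟩
    · exact ⟨1, 1, by simp [hfL]⟩
  | algebraMap c =>
    exact ⟨0, C c, by simp⟩
  | add x y _ _ hx hy =>
    obtain ⟨S, p, hp⟩ := hx
    obtain ⟨T, q, hq⟩ := hy
    refine ⟨S + T, p * X ^ T + q * X ^ S, ?_⟩
    simp only [add_comp, mul_comp, X_pow_comp, map_add, map_mul, map_pow, ← hp, ← hq]
    ring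
  | mul x y _ _ hx hy =>
    obtain ⟨S, p, hp⟩ := hx
    obtain ⟨T, q, hq⟩ := hy
    refine ⟨S + T, p * q, ?_⟩
    simp only [mul_comp, map_mul, ← hp, ← hq]
    ring

theorem zpow_mem_laurentAlgebra (k : ℤ) :
    algebraMap K[X] (RatFunc K) f ^ k ∈ laurentAlgebra f := by
  have h1 : algebraMap K[X] (RatFunc K) f ∈ laurentAlgebra f :=
    Algebra.subset_adjoin (Set.mem_insert _ _)
  have h2 : (algebraMap K[X] (RatFunc K) f)⁻¹ ∈ laurentAlgebra f :=
    Algebra.subset_adjoin (Set.mem_insert_of_mem _ rfl)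
  obtain ⟨k, rfl | rfl⟩ := k.eq_nat_or_neg
  · rw [zpow_natCast]
    exact Subalgebra.pow_mem _ h1 k
  · rw [zpow_neg, zpow_natCast, ← inv_pow]
    exact Subalgebra.pow_mem _ h2 k

theorem mem_span_zpow (hf : f ≠ 0) {b : RatFunc K} (hb : b ∈ laurentAlgebra f) :
    b ∈ Submodule.span K (Set.range fun k : ℤ => algebraMap K[X] (RatFunc K) f ^ k) := by
  have hfL : algebraMap K[X] (RatFunc K) f ≠ 0 := by simpa
  obtain ⟨T, p, hp⟩ := exists_mul_pow_eq hf hb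
  have h1 : b = algebraMap K[X] (RatFunc K) (p.comp f) *
      algebraMap K[X] (RatFunc K) f ^ (-(T : ℤ)) := by
    rw [← hp, mul_assoc, zpow_neg, zpow_natCast, mul_inv_cancel₀ (pow_ne_zero _ hfL), mul_one]
  rw [h1]
  clear h1 hp
  induction p using Polynomial.induction_on' with
  | add p q hp hq =>
    rw [add_comp, map_add, add_mul]
    exact add_mem hp hq
  | monomial n c =>
    have h2 : algebraMap K[X] (RatFunc K) ((monomial n c).comp f) *
        algebraMap K[X] (RatFunc K) f ^ (-(T : ℤ)) =
        c • algebraMap K[X] (RatFunc K) f ^ ((n : ℤ) - T) := by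
      rw [monomial_comp, sub_eq_add_neg, zpow_add₀ hfL, zpow_natCast, Algebra.smul_def,
        IsScalarTower.algebraMap_apply K K[X] (RatFunc K)]
      simp [mul_assoc]
    rw [h2]
    exact Submodule.smul_mem _ _ (Submodule.subset_span ⟨_, rfl⟩)

/-- Base case: up to a power of `f`, a constant polynomial has a value `p.comp f`, of degree
`p.natDegree * f.natDegree`. -/
theorem dvdDegrees_one (hf : 0 < f.natDegree) :
    DvdDegrees (laurentEval f g) 1 f.natDegree := by
  intro u hu hu0
  have hu1 : u.natDegree = 0 := by
    have := natDegree_lt_of_mem_degreeLT one_pos hu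
    omega
  obtain ⟨b, rfl⟩ := natDegree_eq_zero.1 hu1
  have hb0 : (b : RatFunc K) ≠ 0 := by
    simpa using hu0
  have hf0 : f ≠ 0 := by
    rintro rfl
    simp at hf
  have hfL : algebraMap K[X] (RatFunc K) f ≠ 0 := by simpa
  rw [laurentEval_C]
  refine ⟨hb0, ?_⟩
  obtain ⟨T, p, hp⟩ := exists_mul_pow_eq hf0 b.2
  have h1 := congrArg RatFunc.intDegree hp
  rw [RatFunc.intDegree_mul hb0 (pow_ne_zero _ hfL), intDegree_pow hfL,
    RatFunc.intDegree_polynomial, RatFunc.intDegree_polynomial, natDegree_comp] at h1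
  refine ⟨p.natDegree - T, ?_⟩
  push_cast at h1
  linear_combination h1

theorem DvdDegrees.pairEvalRat (hf : 0 < f.natDegree) {N d : ℕ}
    (h : DvdDegrees (laurentEval f g) N d) : DvdDegrees (pairEvalRat f g) N d := by
  intro u hu hu0
  rw [← laurentEval_map]
  refine h _ ?_ ?_
  · rw [mem_degreeLT] at hu ⊢
    exact degree_map_le.trans_lt hu
  · rwa [Ne, Polynomial.map_eq_zero_iff (toLaurentAlgebra_injective hf)]

theorem exists_pairEval_eq {h : K[X]} (hh : h ∈ Algebra.adjoin K ({f, g} : Set K[X])) :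
    ∃ u, pairEval f g u = h := by
  induction hh using Algebra.adjoin_induction with
  | mem x hx =>
    rcases hx with rfl | rfl
    · exact ⟨C X, by simp [pairEval]⟩
    · exact ⟨X, by simp [pairEval]⟩
  | algebraMap c => exact ⟨C (C c), by simp [pairEval]⟩
  | add x y _ _ hx hy =>
    obtain ⟨u, rfl⟩ := hx
    obtain ⟨v, rfl⟩ := hy
    exact ⟨u + v, map_add _ _ _⟩
  | mul x y _ _ hx hy =>
    obtain ⟨u, rfl⟩ := hx
    obtain ⟨v, rfl⟩ := hy
    exact ⟨u * v, map_mul _ _ _⟩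

theorem intDegree_pairEvalRat_nonneg (u : K[X][X]) : 0 ≤ (pairEvalRat f g u).intDegree := by
  simp [pairEvalRat]

/-- Expansion in base `f`: the powers `1, …, z ^ (n - 1)` generate `K[z]` over `K[f]`. -/
theorem exists_eq_sum_comp (hf : 0 < f.natDegree) (p : K[X]) :
    ∃ c : Fin f.natDegree → K[X], p = ∑ i, (c i).comp f * X ^ (i : ℕ) := by
  induction hp : p.natDegree using Nat.strong_induction_on generalizing p with
  | _ l ih =>
    have hlow : ∀ q : K[X], q.natDegree < f.natDegree →
        q = ∑ i : Fin f.natDegree, (C (q.coeff i)).comp f * X ^ (i : ℕ) := by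
      intro q hq
      conv_lhs => rw [q.as_sum_range' _ hq]
      rw [Finset.sum_range]
      simp [C_mul_X_pow_eq_monomial]
    rcases lt_or_ge l f.natDegree with hl | hl
    · exact ⟨_, hlow p (hp ▸ hl)⟩
    · have hlt : (p / f).natDegree < l := by
        by_cases h0 : p / f = 0
        · rw [h0, natDegree_zero]
          omega
        · rw [← hp]
          refine natDegree_lt_natDegree h0 (degree_div_lt ?_ (natDegree_pos_iff_degree_pos.1 hf))
          rintro rfl
          simp at h0
      obtain ⟨c, hc⟩ := ih (p / f).natDegree hlt (p / f) rfl
      have hr : (p % f).natDegree < f.natDegree := natDegree_mod_lt p (by omega)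
      refine ⟨fun i => X * c i + C ((p % f).coeff i), ?_⟩
      conv_lhs => rw [← EuclideanDomain.div_add_mod p f, hc, hlow _ hr]
      simp only [add_comp, mul_comp, X_comp, add_mul, Finset.sum_add_distrib, Finset.mul_sum,
        mul_assoc]

/-- A monic relation of degree `deg f` over `K[f]` for `g`. -/
theorem exists_monic_pairEval_eq_zero (hf : 0 < f.natDegree) :
    ∃ P : K[X][X], P.Monic ∧ P.natDegree = f.natDegree ∧ pairEval f g P = 0 := by
  choose c hc using fun i : Fin f.natDegree => exists_eq_sum_comp hf (g * X ^ (i : ℕ))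
  let M : Matrix (Fin f.natDegree) (Fin f.natDegree) K[X] := Matrix.of c
  refine ⟨M.charpoly, M.charpoly_monic, by simp [Matrix.charpoly_natDegree_eq_dim], ?_⟩
  rw [Matrix.charpoly, RingHom.map_det]
  -- Determinant trick: `M` represents multiplication by `g` on the generators `z ^ i`, whose vector
  -- is killed by `g - M(f)`.
  refine Matrix.exists_mulVec_eq_zero_iff.1 ⟨fun i => X ^ (i : ℕ), ?_, ?_⟩
  · intro h
    have := congrFun h ⟨0, hf⟩
    simp at this
  · ext1 i
    have h1 : ∀ j, (pairEval f g).mapMatrix M.charmatrix i j =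
        (if i = j then g else 0) - (c i j).comp f := by
      intro j
      by_cases hij : i = j
      · subst hij; simp [pairEval, Matrix.charmatrix_apply_eq, M]
      · simp [pairEval, M, hij]
    simp only [Matrix.mulVec, dotProduct, h1, sub_mul, Finset.sum_sub_distrib, ← hc]
    simp

end Evaluation

/-! ### Arithmetic of the greatest common divisors and exponents. -/

section Sequences

theorem not_dvd_mul_of_lt_div_gcd {d : ℕ} {m : ℤ} {j : ℕ} (hj : 0 < j)
    (hjd : j < d / Int.gcd d m) : ¬ (d : ℤ) ∣ j * m := by
  intro h
  have hd : 0 < d := by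
    rcases Nat.eq_zero_or_pos d with rfl | hd
    · simp at hjd
    · exact hd
  have hg : 0 < Int.gcd (d : ℤ) m := Int.gcd_pos_of_ne_zero_left _ (by omega)
  have h1 : ((d / Int.gcd d m : ℕ) : ℤ) ∣ j := by
    have h2 : d ∣ j * m.natAbs := by
      have := Int.natAbs_dvd_natAbs.2 h
      simpa [Int.natAbs_mul] using this
    have h3 : Int.gcd (d : ℤ) m = Nat.gcd d m.natAbs := by simp [Int.gcd]
    rw [h3]
    exact_mod_cast (Nat.Coprime.dvd_of_dvd_mul_right
      (Nat.coprime_div_gcd_div_gcd (h3 ▸ hg)) (by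
        rw [← Nat.mul_div_assoc _ (Nat.gcd_dvd_right _ _)]
        exact Nat.div_dvd_div (Nat.gcd_dvd_left _ _) h2))
  have := Nat.le_of_dvd hj (by exact_mod_cast h1)
  omega

/-- Bézout gives some multiple of `m` congruent to `D` modulo `d`; its factor matters only modulo `d
/ gcd (d, m)`. -/
theorem exists_dvd_sub_mul {d : ℕ} (hd : 0 < d) {m D : ℤ} (h : (Int.gcd d m : ℤ) ∣ D) :
    ∃ j : ℕ, j < d / Int.gcd d m ∧ (d : ℤ) ∣ D - j * m := by
  obtain ⟨e, rfl⟩ := h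
  have hg : 0 < Int.gcd (d : ℤ) m := Int.gcd_pos_of_ne_zero_left _ (by omega)
  obtain ⟨a, ha⟩ : (Int.gcd (d : ℤ) m : ℤ) ∣ d := Int.gcd_dvd_left ..
  obtain ⟨b, hb⟩ : (Int.gcd (d : ℤ) m : ℤ) ∣ m := Int.gcd_dvd_right ..
  have ha0 : 0 < a := by
    by_contra! h
    have : (0 : ℤ) < d := by exact_mod_cast hd
    nlinarith
  have hda : ((d / Int.gcd d m : ℕ) : ℤ) = a := by
    rw [Int.natCast_div]
    nth_rw 1 [ha]
    exact Int.mul_ediv_cancel_left _ (by omega)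
  have hbez := Int.gcd_eq_gcd_ab d m
  generalize Int.gcdB d m = y at hbez
  generalize Int.gcdA d m = x at hbez
  refine ⟨((y * e) % a).toNat, ?_, ?_⟩
  · have := Int.emod_lt_of_pos (y * e) ha0
    have := Int.emod_nonneg (y * e) ha0.ne'
    omega
  · rw [Int.toNat_of_nonneg (Int.emod_nonneg _ ha0.ne')]
    refine ⟨x * e + b * (y * e / a), ?_⟩
    have := Int.emod_add_mul_ediv (y * e) a
    linear_combination e * hbez - m * this + a * (y * e / a) * hb - b * (y * e / a) * ha

variable {n : ℕ} {m : ℕ → ℤ}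

theorem gcdSeq_pos (hn : 0 < n) (i : ℕ) : 0 < gcdSeq n m i := by
  induction i with
  | zero => exact hn
  | succ i ih => exact Int.gcd_pos_of_ne_zero_left _ (by omega)

theorem gcdSeq_succ_dvd (i : ℕ) : gcdSeq n m (i + 1) ∣ gcdSeq n m i := by
  exact_mod_cast Int.gcd_dvd_left (gcdSeq n m i : ℤ) (m i)

theorem gcdSeq_dvd_of_le {i j : ℕ} (h : i ≤ j) : gcdSeq n m j ∣ gcdSeq n m i := by
  induction j, h using Nat.le_induction with
  | base => rfl
  | succ j _ ih => exact (gcdSeq_succ_dvd j).trans ih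

theorem gcdSeq_succ_dvd_apply (i : ℕ) : (gcdSeq n m (i + 1) : ℤ) ∣ m i := Int.gcd_dvd_right ..

theorem expSeq_mul_gcdSeq (i : ℕ) : expSeq n m i * gcdSeq n m (i + 1) = gcdSeq n m i :=
  Nat.div_mul_cancel (gcdSeq_succ_dvd i)

theorem expSeq_pos (hn : 0 < n) (i : ℕ) : 0 < expSeq n m i :=
  Nat.div_pos (Nat.le_of_dvd (gcdSeq_pos hn i) (gcdSeq_succ_dvd i)) (gcdSeq_pos hn _)

/-- The products `a₀ ⋯ aᵢ₋₁`. -/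
def keyDegree (n : ℕ) (m : ℕ → ℤ) (i : ℕ) : ℕ :=
  ∏ j ∈ Finset.range i, expSeq n m j

theorem keyDegree_succ (i : ℕ) : keyDegree n m (i + 1) = expSeq n m i * keyDegree n m i := by
  rw [keyDegree, Finset.prod_range_succ, mul_comm, keyDegree]

theorem keyDegree_pos (hn : 0 < n) (i : ℕ) : 0 < keyDegree n m i :=
  Finset.prod_pos fun _ _ => expSeq_pos hn _

/-- A telescoping product. In particular the key degree reaches `n` exactly when the gcd becomes 1,
which is where the monic relation for `g` applies. -/
theorem keyDegree_mul_gcdSeq (i : ℕ) : keyDegree n m i * gcdSeq n m i = n := by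
  induction i with
  | zero => simp [keyDegree, gcdSeq]
  | succ i ih =>
    have h := expSeq_mul_gcdSeq (n := n) (m := m) i
    rw [keyDegree_succ]
    calc _ = keyDegree n m i * (expSeq n m i * gcdSeq n m (i + 1)) := by ring
      _ = n := by rw [h, ih]

theorem keyDegree_mono (hn : 0 < n) {i j : ℕ} (h : i ≤ j) : keyDegree n m i ≤ keyDegree n m j := by
  induction j, h using Nat.le_induction with
  | base => rfl
  | succ j _ ih =>
    rw [keyDegree_succ]
    exact ih.trans (Nat.le_mul_of_pos_left _ (expSeq_pos hn _))

theorem gcdSeq_congr {m m' : ℕ → ℤ} {i : ℕ} (h : ∀ l < i, m l = m' l) :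
    gcdSeq n m i = gcdSeq n m' i := by
  induction i with
  | zero => rfl
  | succ i ih => rw [gcdSeq, gcdSeq, ih fun l hl => h l (by omega), h i (by omega)]

theorem expSeq_congr {m m' : ℕ → ℤ} {i : ℕ} (h : ∀ l ≤ i, m l = m' l) :
    expSeq n m i = expSeq n m' i := by
  rw [expSeq, expSeq, gcdSeq_congr fun l hl => h l (by omega),
    gcdSeq_congr fun l hl => h l (by omega)]

end Sequences

/-! ### Standard monomials and reductions. -/

section StandardMonomials

variable {K : Type*} [Field K] {f g : K[X]} {G G' : ℕ → RatFunc K} {t : ℕ}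

theorem IsStandardMonomial.congr (h : ∀ l < t, G l = G' l) {M : RatFunc K}
    (hM : IsStandardMonomial f G t M) : IsStandardMonomial f G' t M := by
  obtain ⟨k, j, hj, rfl⟩ := hM
  refine ⟨k, j, fun i hi => ?_, ?_⟩
  · rw [← expSeq_congr (m := degSeq G) fun l hl => by rw [degSeq, degSeq, h l (by omega)]]
    exact hj i hi
  · congr 1
    exact Finset.prod_congr rfl fun i hi => by rw [h i (Finset.mem_range.1 hi)]

theorem Reduces.congr (h : ∀ l < t, G l = G' l) {x y : RatFunc K}
    (hxy : Reduces f G t x y) : Reduces f G' t x y := by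
  obtain ⟨h0, c, M, hM, h1⟩ := hxy
  exact ⟨h0, c, M, hM.congr h, h1⟩

theorem standardMonomial_ne_zero_and_intDegree (hf : f ≠ 0) (h0 : ∀ l < t, G l ≠ 0)
    (k : ℤ) (j : ℕ → ℕ) :
    algebraMap K[X] (RatFunc K) f ^ k * ∏ i ∈ Finset.range t, G i ^ j i ≠ 0 ∧
    (algebraMap K[X] (RatFunc K) f ^ k * ∏ i ∈ Finset.range t, G i ^ j i).intDegree =
      k * f.natDegree + ∑ i ∈ Finset.range t, j i * degSeq G i := by
  have hfL : algebraMap K[X] (RatFunc K) f ≠ 0 := by simpa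
  induction t with
  | zero => simp [hfL, intDegree_zpow hfL, zpow_ne_zero]
  | succ t ih =>
    obtain ⟨h1, h2⟩ := ih fun l hl => h0 l (by omega)
    have h3 := pow_ne_zero (j t) (h0 t (by omega))
    rw [Finset.prod_range_succ, Finset.sum_range_succ, ← mul_assoc]
    refine ⟨mul_ne_zero h1 h3, ?_⟩
    rw [RatFunc.intDegree_mul h1 h3, h2, intDegree_pow (h0 t (by omega)), add_assoc, degSeq]

theorem gcdSeq_dvd_sum {n : ℕ} {m : ℕ → ℤ} (k : ℤ) (j : ℕ → ℕ) (t : ℕ) :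
    (gcdSeq n m t : ℤ) ∣ k * n + ∑ i ∈ Finset.range t, j i * m i := by
  refine dvd_add ?_ (Finset.dvd_sum fun i hi => ?_)
  · exact Dvd.dvd.mul_left (by exact_mod_cast gcdSeq_dvd_of_le (m := m) (Nat.zero_le t)) _
  · refine Dvd.dvd.mul_left (dvd_trans ?_ (gcdSeq_succ_dvd_apply (n := n) i)) _
    exact_mod_cast gcdSeq_dvd_of_le (Finset.mem_range.1 hi)

/-- As in a mixed-radix system, the last exponent is determined by the degree modulo `gcdSeq n m t`;
then descend. -/
theorem standard_exponents_unique {n : ℕ} (hn : 0 < n) {m : ℕ → ℤ} {t : ℕ} {k k' : ℤ}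
    {j j' : ℕ → ℕ} (hj : ∀ i < t, j i < expSeq n m i) (hj' : ∀ i < t, j' i < expSeq n m i)
    (h : k * n + ∑ i ∈ Finset.range t, j i * m i =
      k' * n + ∑ i ∈ Finset.range t, j' i * m i) : k = k' ∧ ∀ i < t, j i = j' i := by
  induction t with
  | zero =>
    refine ⟨?_, fun i hi => by omega⟩
    simpa [hn.ne'] using h
  | succ t ih =>
    have key : ∀ {k k' : ℤ} {j j' : ℕ → ℕ}, (∀ i < t + 1, j i < expSeq n m i) →
        k * n + ∑ i ∈ Finset.range (t + 1), j i * m i =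
          k' * n + ∑ i ∈ Finset.range (t + 1), j' i * m i → ¬ j' t < j t := by
      intro k k' j j' hj h hlt
      refine not_dvd_mul_of_lt_div_gcd (d := gcdSeq n m t) (m := m t) (j := j t - j' t)
        (by omega) (lt_of_le_of_lt (Nat.sub_le _ _) (hj t (by omega))) ?_
      have h1 := dvd_sub (gcdSeq_dvd_sum (m := m) (n := n) k' j' t)
        (gcdSeq_dvd_sum (m := m) (n := n) k j t)
      rw [Finset.sum_range_succ, Finset.sum_range_succ] at h
      have h2 : ((j t - j' t : ℕ) : ℤ) * m t = k' * n + ∑ i ∈ Finset.range t, j' i * m i -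
          (k * n + ∑ i ∈ Finset.range t, j i * m i) := by
        rw [Nat.cast_sub hlt.le]
        linear_combination h
      rwa [h2]
    have ht : j t = j' t := le_antisymm (not_lt.1 (key hj h)) (not_lt.1 (key hj' h.symm))
    rw [Finset.sum_range_succ, Finset.sum_range_succ, ht] at h
    obtain ⟨h1, h2⟩ := ih (fun i hi => hj i (by omega)) (fun i hi => hj' i (by omega))
      (by linear_combination h)
    refine ⟨h1, fun i hi => ?_⟩
    rcases Nat.lt_succ_iff_lt_or_eq.1 hi with hi | rfl
    · exact h2 i hi
    · exact ht

theorem IsStandardMonomial.ne_zero (hf : f ≠ 0) (h0 : ∀ l < t, G l ≠ 0) {M : RatFunc K}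
    (hM : IsStandardMonomial f G t M) : M ≠ 0 := by
  obtain ⟨k, j, -, rfl⟩ := hM
  exact (standardMonomial_ne_zero_and_intDegree hf h0 k j).1

/-- A standard monomial is determined by its degree. -/
theorem IsStandardMonomial.eq_of_intDegree_eq (hf : 0 < f.natDegree) (h0 : ∀ l < t, G l ≠ 0)
    {M M' : RatFunc K} (hM : IsStandardMonomial f G t M) (hM' : IsStandardMonomial f G t M')
    (h : M.intDegree = M'.intDegree) : M = M' := by
  have hf0 : f ≠ 0 := by
    rintro rfl
    simp at hf
  obtain ⟨k, j, hj, rfl⟩ := hM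
  obtain ⟨k', j', hj', rfl⟩ := hM'
  rw [(standardMonomial_ne_zero_and_intDegree hf0 h0 k j).2,
    (standardMonomial_ne_zero_and_intDegree hf0 h0 k' j').2] at h
  obtain ⟨rfl, h2⟩ := standard_exponents_unique hf hj hj' h
  congr 1
  exact Finset.prod_congr rfl fun i hi => by rw [h2 i (Finset.mem_range.1 hi)]

theorem exists_isStandardMonomial (hf : 0 < f.natDegree) (h0 : ∀ l < t, G l ≠ 0) {D : ℤ}
    (hD : (gcdSeq f.natDegree (degSeq G) t : ℤ) ∣ D) :
    ∃ M, IsStandardMonomial f G t M ∧ M.intDegree = D := by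
  have hf0 : f ≠ 0 := by
    rintro rfl
    simp at hf
  suffices H : ∃ (k : ℤ) (j : ℕ → ℕ), (∀ i < t, j i < expSeq f.natDegree (degSeq G) i) ∧
      k * f.natDegree + ∑ i ∈ Finset.range t, j i * degSeq G i = D by
    obtain ⟨k, j, hj, h⟩ := H
    exact ⟨_, ⟨k, j, hj, rfl⟩, by rw [(standardMonomial_ne_zero_and_intDegree hf0 h0 k j).2, h]⟩
  clear h0
  induction t generalizing D with
  | zero =>
    obtain ⟨k, rfl⟩ := hD
    exact ⟨k, 0, fun i hi => by omega, by simp [gcdSeq, mul_comm]⟩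
  | succ t ih =>
    obtain ⟨a, ha, hda⟩ := exists_dvd_sub_mul (gcdSeq_pos hf t) hD
    obtain ⟨k, j, hj, h⟩ := ih hda
    refine ⟨k, Function.update j t a, fun i hi => ?_, ?_⟩
    · by_cases hit : i = t
      · subst hit
        rw [Function.update_self]
        exact ha
      · rw [Function.update_of_ne hit]
        exact hj i (by omega)
    · rw [Finset.sum_range_succ, Function.update_self, Finset.sum_congr rfl (g := fun i =>
        (j i : ℤ) * degSeq G i) fun i hi => by
          rw [Function.update_of_ne (Finset.mem_range.1 hi).ne]]
      linear_combination h

/-- The constant is the leading coefficient of the numerator of `x / y`, which has degree zero and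
monic denominator. -/
theorem exists_sub_C_mul_degLE {x y : RatFunc K} (hx : x ≠ 0) (hy : y ≠ 0)
    (hxy : y.intDegree = x.intDegree) :
    ∃ c : K, DegLE (x - RatFunc.C c * y) (x.intDegree - 1) := by
  have hq : x / y ≠ 0 := div_ne_zero hx hy
  have hq0 : (x / y).intDegree = 0 := by
    rw [RatFunc.intDegree_div hx hy, hxy, sub_self]
  set q := x / y with hqdef
  have hxq : x = q * y := by rw [hqdef, div_mul_cancel₀ _ hy]
  have hdeg : q.num.natDegree = q.denom.natDegree := by
    rw [RatFunc.intDegree] at hq0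
    omega
  have hden : algebraMap K[X] (RatFunc K) q.denom ≠ 0 := by simpa using q.denom_ne_zero
  have key : DegLE (q - RatFunc.C q.num.leadingCoeff) (-1) := by
    set c := q.num.leadingCoeff with hc
    have h1 : q - RatFunc.C c = algebraMap K[X] (RatFunc K) (q.num - C c * q.denom) /
        algebraMap K[X] (RatFunc K) q.denom := by
      rw [map_sub, map_mul, RatFunc.algebraMap_C, sub_div, RatFunc.num_div_denom,
        mul_div_cancel_right₀ _ hden]
    by_cases hp : q.num - C c * q.denom = 0
    · exact Or.inl (by rw [h1, hp, map_zero, zero_div])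
    · have hnum0 : q.num ≠ 0 := RatFunc.num_ne_zero hq
      have hcne : c ≠ 0 := leadingCoeff_ne_zero.2 hnum0
      have hlt : (q.num - C c * q.denom).natDegree < q.num.natDegree := by
        refine natDegree_lt_natDegree hp (degree_sub_lt_left ?_ hnum0 ?_)
        · rw [degree_C_mul hcne, degree_eq_natDegree hnum0, degree_eq_natDegree q.denom_ne_zero,
            hdeg]
        · rw [leadingCoeff_mul, leadingCoeff_C, (RatFunc.monic_denom q).leadingCoeff, mul_one]
      refine Or.inr ?_
      rw [h1, RatFunc.intDegree_div
        ((map_ne_zero_iff _ (RatFunc.algebraMap_injective K)).2 hp) hden, RatFunc.intDegree_polynomial,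
        RatFunc.intDegree_polynomial]
      omega
  refine ⟨q.num.leadingCoeff, ?_⟩
  have h2 : x - RatFunc.C q.num.leadingCoeff * y = (q - RatFunc.C q.num.leadingCoeff) * y := by
    rw [sub_mul, ← hxq]
  rw [h2]
  exact (key.mul (DegLE.of_le le_rfl)).mono (by omega)

theorem exists_reduces (hf : 0 < f.natDegree) (h0 : ∀ l < t, G l ≠ 0) {h : RatFunc K} (hh : h ≠ 0)
    (hd : (gcdSeq f.natDegree (degSeq G) t : ℤ) ∣ h.intDegree) : ∃ h', Reduces f G t h h' := by
  have hf0 : f ≠ 0 := by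
    rintro rfl
    simp at hf
  obtain ⟨M, hM, hMd⟩ := exists_isStandardMonomial hf h0 hd
  obtain ⟨c, hc⟩ := exists_sub_C_mul_degLE hh (hM.ne_zero hf0 h0) hMd
  exact ⟨_, hh, c, M, hM, hMd, rfl, hc.imp_right fun h => by omega⟩

theorem Reduces.degLE {x y : RatFunc K} (h : Reduces f G t x y) : DegLE y (x.intDegree - 1) := by
  obtain ⟨-, c, M, -, -, -, h1⟩ := h
  exact h1.imp_right fun h => by omega

theorem degLE_of_reduces_chain {x y : RatFunc K} {D : ℤ}
    (h : Relation.ReflTransGen (Reduces f G t) x y) (hx : DegLE x D) : DegLE y D := by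
  induction h with
  | refl => exact hx
  | tail _ hbc ih => exact hbc.degLE.mono (by have := ih.le hbc.1; omega)

theorem degLE_sum {ι : Type*} (s : Finset ι) (x : ι → RatFunc K) {D : ℤ}
    (h : ∀ i ∈ s, DegLE (x i) D) : DegLE (∑ i ∈ s, x i) D :=
  Finset.sum_induction _ (fun y => DegLE y D) (fun _ _ => DegLE.add) DegLE.zero h

/-- A linear combination of standard monomials can be reduced to zero. -/
theorem reduces_sum_to_zero (hf : 0 < f.natDegree) (h0 : ∀ l < t, G l ≠ 0) (c : RatFunc K → K)
    (T : Finset (RatFunc K)) (hT : ∀ M ∈ T, IsStandardMonomial f G t M) (hc : ∀ M ∈ T, c M ≠ 0) :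
    Relation.ReflTransGen (Reduces f G t) (∑ M ∈ T, RatFunc.C (c M) * M) 0 := by
  have hf0 : f ≠ 0 := by
    rintro rfl
    simp at hf
  classical
  induction T using Finset.strongInduction with
  | H T ih =>
    rcases T.eq_empty_or_nonempty with rfl | hne
    · rw [Finset.sum_empty]
    -- Distinct standard monomials have distinct degrees, so the one of largest degree carries the
    -- degree of the sum and is removed by a single reduction.
    obtain ⟨M, hM, hmax⟩ := T.exists_max_image RatFunc.intDegree hne
    refine Relation.ReflTransGen.head ?_ (ih (T.erase M) (Finset.erase_ssubset hM)
      (fun M' h => hT M' (Finset.mem_of_mem_erase h))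
      (fun M' h => hc M' (Finset.mem_of_mem_erase h)))
    have hM0 := (hT M hM).ne_zero hf0 h0
    have hcM : RatFunc.C (c M) ≠ 0 := by simpa using hc M hM
    have hdeg : (RatFunc.C (c M) * M).intDegree = M.intDegree := by
      rw [RatFunc.intDegree_mul hcM hM0, RatFunc.intDegree_C, zero_add]
    have hrest : DegLE (∑ M' ∈ T.erase M, RatFunc.C (c M') * M') (M.intDegree - 1) := by
      refine degLE_sum _ _ fun M' hM' => ?_
      obtain ⟨hne, hM'T⟩ := Finset.mem_erase.1 hM'
      have h1 : M'.intDegree < M.intDegree := lt_of_le_of_ne (hmax M' hM'T) fun h =>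
        hne ((hT M' hM'T).eq_of_intDegree_eq hf h0 (hT M hM) h)
      exact (DegLE.mul (DegLE.of_le (RatFunc.intDegree_C _).le) (DegLE.of_le le_rfl)).mono
        (by omega)
    have hsum := Finset.add_sum_erase T (fun M => RatFunc.C (c M) * M) hM
    obtain ⟨h1, h2⟩ := intDegree_add_of_degLE (mul_ne_zero hcM hM0) (by rwa [hdeg])
    rw [hsum] at h1 h2
    refine ⟨h1, c M, M, hT M hM, by rw [h2, hdeg], ?_, ?_⟩
    · rw [← hsum]; ring
    · rw [h2, hdeg]
      exact hrest.imp_right fun h => by omega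

end StandardMonomials

/-! ### Monic lifts and execution of the algorithm. -/

section Lift

variable {K : Type*} [Field K] {f g : K[X]} {G G' : ℕ → RatFunc K} {t : ℕ}

/-- `x` is the value of a monic polynomial of degree `a₀ ⋯ aₜ₋₁` with coefficients in
`K[f, f⁻¹]`. -/
def HasMonicLift (f g : K[X]) (G : ℕ → RatFunc K) (t : ℕ) (x : RatFunc K) : Prop :=
  ∃ Ψ : (laurentAlgebra f)[X], Ψ.Monic ∧ Ψ.natDegree = keyDegree f.natDegree (degSeq G) t ∧
    laurentEval f g Ψ = x

/-- `x` is obtained from the `i`-th member of the sequence by the reductions of one step of the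
algorithm. -/
def ReductionStep (f : K[X]) (G : ℕ → RatFunc K) (i : ℕ) (x : RatFunc K) : Prop :=
  ∃ h : RatFunc K, Reduces f G i (G i ^ expSeq f.natDegree (degSeq G) i) h ∧
    Relation.ReflTransGen (Reduces f G (i + 1)) h x

theorem ReductionStep.congr (h : ∀ l ≤ t, G l = G' l) {x : RatFunc K}
    (hx : ReductionStep f G t x) : ReductionStep f G' t x := by
  obtain ⟨y, h1, h2⟩ := hx
  have hle : Reduces f G (t + 1) ≤ Reduces f G' (t + 1) := fun a b hab =>
    hab.congr fun l hl => h l (by omega)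
  refine ⟨y, ?_, Relation.ReflTransGen.mono hle _ _ h2⟩
  rw [← h t le_rfl, ← expSeq_congr (m := degSeq G) fun l hl => by rw [degSeq, degSeq, h l hl]]
  exact h1.congr fun l hl => h l hl.le

theorem IsStandardMonomial.exists_lift
    (hG : ∀ i < t, HasMonicLift f g G i (G i)) {M : RatFunc K} (hM : IsStandardMonomial f G t M) :
    ∃ u ∈ degreeLT (laurentAlgebra f) (keyDegree f.natDegree (degSeq G) t),
      laurentEval f g u = M := by
  obtain ⟨k, j, hj, rfl⟩ := hM
  induction t with
  | zero =>
    refine ⟨C ⟨_, zpow_mem_laurentAlgebra k⟩,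
      mem_degreeLT_of_natDegree_lt (by simp [keyDegree]), ?_⟩
    rw [laurentEval_C]
    simp
  | succ t ih =>
    obtain ⟨u, hu, huM⟩ := ih (fun i hi => hG i (by omega)) fun i hi => hj i (by omega)
    obtain ⟨ψ, hψ, hψN, hψG⟩ := hG t (by omega)
    refine ⟨u * ψ ^ j t, ?_, ?_⟩
    · have h1 := mul_mem_degreeLT hu (le_refl (ψ ^ j t).natDegree)
      rw [hψ.natDegree_pow, hψN] at h1
      refine degreeLT_mono ?_ h1
      rw [keyDegree_succ, add_comm, ← Nat.succ_mul]
      exact Nat.mul_le_mul_right _ (hj t (by omega))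
    · rw [map_mul, map_pow, huM, hψG, Finset.prod_range_succ, mul_assoc]

/-- A standard monomial lifts to degree below the key degree, so subtracting it keeps the lift
monic. Allowing `s ≤ t` covers the first reduction of a step, which uses fewer members. -/
theorem HasMonicLift.reduces (hf : 0 < f.natDegree) (hG : ∀ i < t, HasMonicLift f g G i (G i))
    {s : ℕ} (hst : s ≤ t) {x y : RatFunc K} (hx : HasMonicLift f g G t x)
    (hxy : Reduces f G s x y) : HasMonicLift f g G t y := by
  obtain ⟨Ψ, hΨ, hΨN, rfl⟩ := hx
  obtain ⟨-, c, M, hM, -, rfl, -⟩ := hxy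
  obtain ⟨u, hu, rfl⟩ := hM.exists_lift fun i hi => hG i (by omega)
  have hv : -(algebraMap K (laurentAlgebra f) c • u) ∈
      degreeLT (laurentAlgebra f) (keyDegree f.natDegree (degSeq G) t) :=
    neg_mem (Submodule.smul_mem _ _ (degreeLT_mono (keyDegree_mono hf hst) hu))
  obtain ⟨h1, h2⟩ := monic_add_of_mem_degreeLT hΨ hΨN hv
  refine ⟨_, h1, h2, ?_⟩
  rw [map_add, map_neg, smul_eq_C_mul, map_mul, laurentEval_C, ← sub_eq_add_neg]
  simp [RatFunc.algebraMap_eq_C]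

theorem HasMonicLift.reduces_chain (hf : 0 < f.natDegree)
    (hG : ∀ i < t, HasMonicLift f g G i (G i)) {x y : RatFunc K} (hx : HasMonicLift f g G t x)
    (hxy : Relation.ReflTransGen (Reduces f G t) x y) : HasMonicLift f g G t y := by
  induction hxy with
  | refl => exact hx
  | tail _ h ih => exact ih.reduces hf hG le_rfl h

theorem HasMonicLift.pow {x : RatFunc K} (hx : HasMonicLift f g G t x) :
    HasMonicLift f g G (t + 1) (x ^ expSeq f.natDegree (degSeq G) t) := by
  obtain ⟨Ψ, hΨ, hΨN, rfl⟩ := hx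
  exact ⟨_, hΨ.pow _, by rw [hΨ.natDegree_pow, hΨN, keyDegree_succ], map_pow _ _ _⟩

theorem ReductionStep.hasMonicLift (hf : 0 < f.natDegree)
    (hG : ∀ i ≤ t, HasMonicLift f g G i (G i)) {x : RatFunc K} (hx : ReductionStep f G t x) :
    HasMonicLift f g G (t + 1) x := by
  obtain ⟨y, h1, h2⟩ := hx
  have hG' : ∀ i < t + 1, HasMonicLift f g G i (G i) := fun i hi => hG i (by omega)
  exact ((hG t le_rfl).pow.reduces hf hG' (by omega) h1).reduces_chain hf hG' h2

theorem hasMonicLift_of_steps (hf : 0 < f.natDegree) (h0 : G 0 = algebraMap K[X] (RatFunc K) g)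
    (hstep : ∀ i < t, ReductionStep f G i (G (i + 1))) :
    ∀ i ≤ t, HasMonicLift f g G i (G i) := by
  intro i
  induction i using Nat.strong_induction_on with
  | _ i ih =>
    intro hi
    cases i with
    | zero => exact ⟨X, monic_X, by simp [keyDegree], by rw [laurentEval_X, h0]⟩
    | succ i =>
      exact (hstep i (by omega)).hasMonicLift hf fun l hl => ih l (by omega) (by omega)

theorem ReductionStep.degLE {x : RatFunc K} (hG : G t ≠ 0) (hx : ReductionStep f G t x) :
    DegLE x (expSeq f.natDegree (degSeq G) t * degSeq G t - 1) := by
  obtain ⟨y, h1, h2⟩ := hx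
  refine degLE_of_reduces_chain h2 ?_
  have := h1.degLE
  rwa [intDegree_pow hG] at this

theorem isKeyPolynomial_of_dvdDegrees {R : Type*} [CommRing R] {ev : R[X] →+* RatFunc K} {ψ : R[X]}
    (hd : DvdDegrees ev (keyDegree f.natDegree (degSeq G) t) (gcdSeq f.natDegree (degSeq G) t))
    (hψ : ψ.Monic) (hψN : ψ.natDegree = keyDegree f.natDegree (degSeq G) t)
    (h0 : ev ψ ≠ 0) (hψd : (ev ψ).intDegree = degSeq G t) :
    IsKeyPolynomial ev (keyDegree f.natDegree (degSeq G) t) (gcdSeq f.natDegree (degSeq G) t)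
      (expSeq f.natDegree (degSeq G) t) ψ :=
  ⟨hd, hψ, hψN, h0, fun j hj hja => by rw [hψd]; exact not_dvd_mul_of_lt_div_gcd hj hja⟩

theorem dvdDegrees_and_boundsTopCoeff (hf : 0 < f.natDegree)
    (hG : ∀ i < t, HasMonicLift f g G i (G i)) (h0 : ∀ i < t, G i ≠ 0) :
    DvdDegrees (laurentEval f g) (keyDegree f.natDegree (degSeq G) t)
      (gcdSeq f.natDegree (degSeq G) t) ∧
    BoundsTopCoeff (laurentEval f g) (keyDegree f.natDegree (degSeq G) t) := by
  induction t with
  | zero => exact ⟨dvdDegrees_one hf, boundsTopCoeff_one⟩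
  | succ t ih =>
    obtain ⟨h1, h2⟩ := ih (fun i hi => hG i (by omega)) fun i hi => h0 i (by omega)
    obtain ⟨ψ, hψ, hψN, hψG⟩ := hG t (by omega)
    have hk := isKeyPolynomial_of_dvdDegrees h1 hψ hψN
      (by rw [hψG]; exact h0 t (by omega)) (by rw [hψG, degSeq])
    rw [keyDegree_succ]
    refine ⟨?_, hk.boundsTopCoeff_mul (keyDegree_pos hf t) (expSeq_pos hf t) h2⟩
    have := hk.dvdDegrees_mul
    rwa [hψG] at this

/-- Iterated expansion: first in powers of the lift of the last member, then the coefficients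
likewise, down to Laurent polynomials in `f`. -/
theorem laurentEval_mem_span (hf : 0 < f.natDegree) (hG : ∀ i < t, HasMonicLift f g G i (G i))
    {u : (laurentAlgebra f)[X]}
    (hu : u ∈ degreeLT (laurentAlgebra f) (keyDegree f.natDegree (degSeq G) t)) :
    laurentEval f g u ∈ Submodule.span K {M | IsStandardMonomial f G t M} := by
  have hf0 : f ≠ 0 := by
    rintro rfl
    simp at hf
  induction t generalizing u with
  | zero =>
    have hu1 : u.natDegree = 0 := by
      have := natDegree_lt_of_mem_degreeLT one_pos hu
      omega
    obtain ⟨b, rfl⟩ := natDegree_eq_zero.1 hu1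
    rw [laurentEval_C]
    refine Submodule.span_mono ?_ (mem_span_zpow hf0 b.2)
    rintro _ ⟨k, rfl⟩
    exact ⟨k, 0, fun i hi => by omega, by simp⟩
  | succ t ih =>
    obtain ⟨ψ, hψ, hψN, hψG⟩ := hG t (by omega)
    rw [keyDegree_succ] at hu
    suffices H : ∀ k ≤ expSeq f.natDegree (degSeq G) t, ∀ u ∈ degreeLT (laurentAlgebra f)
        (k * keyDegree f.natDegree (degSeq G) t),
        laurentEval f g u ∈ Submodule.span K {M | IsStandardMonomial f G (t + 1) M} from
      H _ le_rfl u hu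
    intro k hk
    induction k with
    | zero =>
      intro u hu
      have : u = 0 := by
        have := mem_degreeLT.1 hu
        simpa using this
      rw [this, map_zero]
      exact zero_mem _
    | succ k ihk =>
      intro u hu
      have hm : (ψ ^ k).Monic := hψ.pow k
      have hmN : (ψ ^ k).natDegree = k * keyDegree f.natDegree (degSeq G) t := by
        rw [hψ.natDegree_pow, hψN]
      rw [← modByMonic_add_div u (ψ ^ k), map_add, map_mul, map_pow, hψG]
      refine add_mem (ihk (by omega) _ ?_) ?_
      · rw [← hmN]
        exact modByMonic_mem_degreeLT hm
      · have h1 := ih (fun i hi => hG i (by omega))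
          (divByMonic_mem_degreeLT (M := keyDegree f.natDegree (degSeq G) t) hm hmN
            (by rwa [add_comm, ← Nat.succ_mul]))
        refine Submodule.span_induction (p := fun y _ => G t ^ k * y ∈
          Submodule.span K {M | IsStandardMonomial f G (t + 1) M}) ?_ ?_ ?_ ?_ h1
        · rintro M ⟨l, j, hj, rfl⟩
          refine Submodule.subset_span ⟨l, Function.update j t k, fun i hi => ?_, ?_⟩
          · by_cases hit : i = t
            · subst hit
              rw [Function.update_self]
              omega
            · rw [Function.update_of_ne hit]
              exact hj i (by omega)
          · have hprod : ∏ i ∈ Finset.range t, G i ^ Function.update j t k i =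
                ∏ i ∈ Finset.range t, G i ^ j i := Finset.prod_congr rfl fun i hi => by
              rw [Function.update_of_ne (Finset.mem_range.1 hi).ne]
            rw [Finset.prod_range_succ, Function.update_self, hprod]
            ring
        · rw [mul_zero]
          exact zero_mem _
        · intro x y _ _ hx hy
          rw [mul_add]
          exact add_mem hx hy
        · intro c x _ hx
          rw [mul_smul_comm]
          exact Submodule.smul_mem _ _ hx

theorem reduces_to_zero_of_mem_span (hf : 0 < f.natDegree) (h0 : ∀ l < t, G l ≠ 0) {x : RatFunc K}
    (hx : x ∈ Submodule.span K {M | IsStandardMonomial f G t M}) :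
    Relation.ReflTransGen (Reduces f G t) x 0 := by
  obtain ⟨c, hc, rfl⟩ := Submodule.mem_span_set.1 hx
  have h1 : (c.sum fun M r => r • M) = ∑ M ∈ c.support, RatFunc.C (c M) * M :=
    Finset.sum_congr rfl fun M _ => RatFunc.smul_eq_C_mul (c M) M
  rw [h1]
  exact reduces_sum_to_zero hf h0 c _ (fun M hM => hc hM) fun M hM => Finsupp.mem_support_iff.1 hM

/-- When the degrees of the monic lifts are bounded below, the reductions stop at an element whose
degree is not divisible by the current greatest common divisor. -/
theorem exists_reduces_not_dvd (hf : 0 < f.natDegree) (hG : ∀ i < t, HasMonicLift f g G i (G i))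
    (h0 : ∀ i < t, G i ≠ 0) {C D : ℤ}
    (hC : ∀ x, HasMonicLift f g G t x → DegLE x D → ¬ DegLE x C) {x : RatFunc K}
    (hx : HasMonicLift f g G t x) (hxD : DegLE x D) :
    ∃ y, Relation.ReflTransGen (Reduces f G t) x y ∧ y ≠ 0 ∧
      ¬ (gcdSeq f.natDegree (degSeq G) t : ℤ) ∣ y.intDegree := by
  suffices H : ∀ (k : ℕ) (x : RatFunc K), HasMonicLift f g G t x → DegLE x D →
      x.intDegree ≤ C + k → ∃ y, Relation.ReflTransGen (Reduces f G t) x y ∧ y ≠ 0 ∧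
      ¬ (gcdSeq f.natDegree (degSeq G) t : ℤ) ∣ y.intDegree from
    H (x.intDegree - C).toNat x hx hxD (by omega)
  intro k
  induction k with
  | zero =>
    intro x hx hxD hk
    exact absurd (DegLE.of_le (by simpa using hk)) (hC x hx hxD)
  | succ k ih =>
    intro x hx hxD hk
    have hx0 : x ≠ 0 := by
      rintro rfl
      exact hC 0 hx hxD DegLE.zero
    by_cases hd : (gcdSeq f.natDegree (degSeq G) t : ℤ) ∣ x.intDegree
    · obtain ⟨y, hy⟩ := exists_reduces hf h0 hx0 hd
      have hyl := hx.reduces hf hG le_rfl hy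
      have hyD : DegLE y D := hy.degLE.mono (by have := hxD.le hx0; omega)
      have hy0 : y ≠ 0 := by
        rintro rfl
        exact hC 0 hyl hyD DegLE.zero
      obtain ⟨w, hw, hw'⟩ := ih y hyl hyD (by have := hy.degLE.le hy0; push_cast at hk; omega)
      exact ⟨w, hw.head hy, hw'⟩
    · exact ⟨x, Relation.ReflTransGen.refl, hx0, hd⟩

/-- One step of the algorithm can be carried out. -/
theorem exists_reductionStep (hf : 0 < f.natDegree) (hG : ∀ i ≤ t, HasMonicLift f g G i (G i))
    (h0 : ∀ i ≤ t, G i ≠ 0) {u : (laurentAlgebra f)[X]} (hu : (laurentEval f g u).intDegree = 1) :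
    ReductionStep f G t 0 ∨ ∃ x, ReductionStep f G t x ∧ x ≠ 0 ∧
      ¬ (gcdSeq f.natDegree (degSeq G) (t + 1) : ℤ) ∣ x.intDegree := by
  have hG' : ∀ i < t + 1, HasMonicLift f g G i (G i) := fun i hi => hG i (by omega)
  have h0' : ∀ i < t + 1, G i ≠ 0 := fun i hi => h0 i (by omega)
  obtain ⟨h1, h2⟩ := dvdDegrees_and_boundsTopCoeff hf hG' h0'
  obtain ⟨y, hy⟩ := exists_reduces (f := f) (t := t) hf (fun l hl => h0 l hl.le)
    (pow_ne_zero (expSeq f.natDegree (degSeq G) t) (h0 t le_rfl)) (by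
      rw [intDegree_pow (h0 t le_rfl)]
      obtain ⟨b, hb⟩ := gcdSeq_succ_dvd_apply (n := f.natDegree) (m := degSeq G) t
      refine ⟨b, ?_⟩
      rw [← expSeq_mul_gcdSeq t]
      rw [degSeq] at hb
      push_cast
      linear_combination (expSeq f.natDegree (degSeq G) t : ℤ) * hb)
  have hyl : HasMonicLift f g G (t + 1) y := (hG t le_rfl).pow.reduces hf hG' (by omega) hy
  by_cases hd : gcdSeq f.natDegree (degSeq G) (t + 1) = 1
  · left
    refine ⟨y, hy, reduces_to_zero_of_mem_span hf h0' ?_⟩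
    obtain ⟨Ψ, hΨ, hΨN, rfl⟩ := hyl
    obtain ⟨P, hP, hPN, hPg⟩ := exists_monic_pairEval_eq_zero (g := g) hf
    have hn := keyDegree_mul_gcdSeq (n := f.natDegree) (m := degSeq G) (t + 1)
    rw [hd, mul_one] at hn
    -- Here `Ψ` and `P` are both monic of degree `n`, and the value of `P` is zero.
    have h3 : laurentEval f g Ψ = laurentEval f g (Ψ - P.map (toLaurentAlgebra f)) := by
      rw [map_sub, laurentEval_map, pairEvalRat, RingHom.comp_apply, hPg, map_zero, sub_zero]
    rw [h3]
    refine laurentEval_mem_span hf hG' (sub_mem_degreeLT_of_monic hΨ (hP.map _) hΨN ?_)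
    rw [hP.natDegree_map, hPN, hn]
  · right
    obtain ⟨C, hC⟩ := h2.bounded_below (keyDegree_pos hf _) h1 (u := u) (by
      rw [hu]
      intro h
      exact hd (Nat.dvd_one.1 (by exact_mod_cast h))) y.intDegree
    obtain ⟨x, hx, hx'⟩ := exists_reduces_not_dvd hf hG' h0' (C := C) (D := y.intDegree) (by
      rintro _ ⟨Ψ, hΨ, hΨN, rfl⟩
      exact hC Ψ hΨ hΨN) hyl (DegLE.of_le le_rfl)
    exact ⟨x, ⟨y, hy, hx⟩, hx'⟩

/-- Any partial run extends to a complete one, by strong induction on the current gcd: a nonzero new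
member has degree not divisible by it, so the gcd drops. -/
theorem exists_algorithmOutput_of_steps (hf : 0 < f.natDegree) {u : (laurentAlgebra f)[X]}
    (hu : (laurentEval f g u).intDegree = 1) (h0 : G 0 = algebraMap K[X] (RatFunc K) g)
    (hne : ∀ i ≤ t, G i ≠ 0) (hstep : ∀ i < t, ReductionStep f G i (G (i + 1)))
    (hnd : ∀ i < t, ¬ (gcdSeq f.natDegree (degSeq G) (i + 1) : ℤ) ∣ degSeq G (i + 1)) :
    ∃ (s : ℕ) (G : ℕ → RatFunc K), IsAlgorithmOutput f g s G := by
  induction hd : gcdSeq f.natDegree (degSeq G) (t + 1) using Nat.strong_induction_on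
    generalizing t G with
  | _ d ih =>
    have hupd : ∀ x, ∀ l ≤ t, G l = Function.update G (t + 1) x l := fun x l hl => by
      rw [Function.update_of_ne (by omega)]
    have hstep' : ∀ x, ReductionStep f G t x → ∀ i < t + 1, ReductionStep f
        (Function.update G (t + 1) x) i (Function.update G (t + 1) x (i + 1)) := by
      intro x hx i hi
      rcases Nat.lt_succ_iff_lt_or_eq.1 hi with hi | rfl
      · rw [← hupd x (i + 1) (by omega)]
        exact (hstep i hi).congr fun l hl => hupd x l (by omega)
      · rw [Function.update_self]
        exact hx.congr (hupd x)
    have hgcd : ∀ x, ∀ i ≤ t + 1, gcdSeq f.natDegree (degSeq (Function.update G (t + 1) x)) i =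
        gcdSeq f.natDegree (degSeq G) i := fun x i hi => gcdSeq_congr fun l hl => by
      rw [degSeq, degSeq, ← hupd x l (by omega)]
    have hnd' : ∀ x, ∀ i < t,
        ¬ (gcdSeq f.natDegree (degSeq (Function.update G (t + 1) x)) (i + 1) : ℤ) ∣
        degSeq (Function.update G (t + 1) x) (i + 1) := by
      intro x i hi
      rw [hgcd x _ (by omega), degSeq, ← hupd x _ (by omega)]
      exact hnd i hi
    have hl := hasMonicLift_of_steps hf h0 hstep
    rcases exists_reductionStep hf hl hne hu with h | ⟨x, hx, hx0, hxd⟩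
    · refine ⟨t, Function.update G (t + 1) 0, ?_, ?_, ?_, hnd' 0, Function.update_self ..⟩
      · rw [← hupd 0 0 (by omega), h0]
      · intro i hi
        rw [← hupd 0 i hi]
        exact hne i hi
      · intro i hi
        exact hstep' 0 h i (by omega)
    · refine ih _ ?_ (t := t + 1) (G := Function.update G (t + 1) x) ?_ ?_ (hstep' x hx) ?_ rfl
      · rw [← hd, ← hgcd x (t + 1) le_rfl]
        refine lt_of_le_of_ne (Nat.le_of_dvd (gcdSeq_pos hf _) (gcdSeq_succ_dvd _)) fun h => hxd ?_
        have h1 := gcdSeq_succ_dvd_apply (n := f.natDegree)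
          (m := degSeq (Function.update G (t + 1) x)) (t + 1)
        rwa [h, hgcd x _ le_rfl, degSeq, Function.update_self] at h1
      · rw [← hupd x 0 (by omega), h0]
      · intro i hi
        rcases Nat.le_succ_iff.1 hi with hi | rfl
        · rw [← hupd x i hi]
          exact hne i hi
        · rwa [Function.update_self]
      · intro i hi
        rcases Nat.lt_succ_iff_lt_or_eq.1 hi with hi | rfl
        · exact hnd' x i hi
        · rwa [hgcd x _ le_rfl, degSeq, Function.update_self]

end Lift

/-! ### Degrees of the output via approximate roots. -/

section Output

variable {K : Type*} [Field K] {f g : K[X]} {G : ℕ → RatFunc K} {s : ℕ}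

namespace IsAlgorithmOutput

theorem hasMonicLift (hf : 0 < f.natDegree) (out : IsAlgorithmOutput f g s G) :
    ∀ i ≤ s + 1, HasMonicLift f g G i (G i) :=
  hasMonicLift_of_steps hf out.start fun i hi => out.step i (by omega)

theorem dvdDegrees (hf : 0 < f.natDegree) (out : IsAlgorithmOutput f g s G) {i : ℕ}
    (hi : i ≤ s + 1) : DvdDegrees (laurentEval f g) (keyDegree f.natDegree (degSeq G) i)
      (gcdSeq f.natDegree (degSeq G) i) :=
  (dvdDegrees_and_boundsTopCoeff hf (fun l hl => out.hasMonicLift hf l (by omega))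
    fun l hl => out.ne_zero l (by omega)).1

/-- If some polynomial in `f` and `g` has degree one, the last greatest common divisor is one. -/
theorem gcdSeq_last (hf : 0 < f.natDegree) (out : IsAlgorithmOutput f g s G) {u : K[X][X]}
    (hu : (pairEvalRat f g u).intDegree = 1) : gcdSeq f.natDegree (degSeq G) (s + 1) = 1 := by
  obtain ⟨ψ, hψ, hψN, hψG⟩ := out.hasMonicLift hf (s + 1) le_rfl
  -- The lift `ψ` of `G (s + 1) = 0` has value zero, so the remainder keeps the value of `u`, of
  -- degree 1.
  have h1 := out.dvdDegrees hf le_rfl (u.map (toLaurentAlgebra f) %ₘ ψ)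
    (by rw [← hψN]; exact modByMonic_mem_degreeLT hψ)
  have h2 : laurentEval f g (u.map (toLaurentAlgebra f) %ₘ ψ) = pairEvalRat f g u := by
    rw [← laurentEval_map]
    conv_rhs => rw [← modByMonic_add_div (u.map (toLaurentAlgebra f)) ψ]
    rw [map_add, map_mul, hψG, out.terminates, zero_mul, add_zero]
  rw [h2, hu] at h1
  have h3 : u.map (toLaurentAlgebra f) %ₘ ψ ≠ 0 := by
    intro h
    rw [h, map_zero] at h2
    rw [← h2] at hu
    simp at hu
  exact Nat.dvd_one.1 (by exact_mod_cast (h1 h3).2)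

/-- For `i > 0`, `aᵢ` divides `d₀ = gcd (deg f, deg g)`; nothing of the kind holds for `a₀`, and it
is not needed. -/
theorem isUnit_expSeq {R : Type*} [CommRing R] [Algebra K R]
    (hK : ((Nat.gcd f.natDegree g.natDegree : ℕ) : K) ≠ 0) (out : IsAlgorithmOutput f g s G)
    {i : ℕ} (hi : 0 < i) : IsUnit ((expSeq f.natDegree (degSeq G) i : ℕ) : R) := by
  have h1 : gcdSeq f.natDegree (degSeq G) 1 = Nat.gcd f.natDegree g.natDegree := by
    rw [gcdSeq, gcdSeq, degSeq, out.start, RatFunc.intDegree_polynomial, Int.gcd_natCast_natCast]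
  have h2 : expSeq f.natDegree (degSeq G) i ∣ Nat.gcd f.natDegree g.natDegree := by
    rw [← h1]
    exact (Dvd.intro _ (expSeq_mul_gcdSeq i)).trans (gcdSeq_dvd_of_le hi)
  have h3 : ((expSeq f.natDegree (degSeq G) i : ℕ) : K) ≠ 0 := by
    intro h
    obtain ⟨c, hc⟩ := h2
    rw [hc, Nat.cast_mul, h, zero_mul] at hK
    exact hK rfl
  have h4 := (IsUnit.mk0 _ h3).map (algebraMap K R)
  rwa [map_natCast] at h4

/-- Approximate roots, taken successively from the last one, are polynomials in `f` and `g` that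
have the degrees of the members of the sequence. -/
theorem exists_approximate_roots (hf : 0 < f.natDegree)
    (hK : ((Nat.gcd f.natDegree g.natDegree : ℕ) : K) ≠ 0) (out : IsAlgorithmOutput f g s G)
    (hlast : gcdSeq f.natDegree (degSeq G) (s + 1) = 1) {i : ℕ} (hi : i ≤ s) :
    ∃ A : K[X][X], A.Monic ∧ A.natDegree = keyDegree f.natDegree (degSeq G) (i + 1) ∧
      DegLE (pairEvalRat f g A) (expSeq f.natDegree (degSeq G) i * degSeq G i - 1) ∧
      (i < s → pairEvalRat f g A ≠ 0 ∧ (pairEvalRat f g A).intDegree = degSeq G (i + 1)) := by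
  induction hi using Nat.decreasingInduction with
  | self =>
    obtain ⟨P, hP, hPN, hPg⟩ := exists_monic_pairEval_eq_zero (g := g) hf
    have hn := keyDegree_mul_gcdSeq (n := f.natDegree) (m := degSeq G) (s + 1)
    rw [hlast, mul_one] at hn
    exact ⟨P, hP, by rw [hPN, hn], Or.inl (by rw [pairEvalRat, RingHom.comp_apply, hPg, map_zero]),
      fun h => absurd h (lt_irrefl _)⟩
  | of_succ i hi ih =>
    obtain ⟨Q, hQ, hQN, hQd, -⟩ := ih
    obtain ⟨ψ, hψ, hψN, hψG⟩ := out.hasMonicLift hf (i + 1) (by omega)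
    have hne := out.ne_zero (i + 1) (by omega)
    have hkey := isKeyPolynomial_of_dvdDegrees (out.dvdDegrees hf (by omega)) hψ hψN
      (by rwa [hψG]) (by rw [hψG, degSeq])
    have hpos := expSeq_pos (m := degSeq G) hf (i + 1)
    -- Exponent 1 would mean that the gcd did not drop, against `not_dvd`.
    have hone : expSeq f.natDegree (degSeq G) (i + 1) ≠ 1 := by
      intro h
      have h1 := expSeq_mul_gcdSeq (n := f.natDegree) (m := degSeq G) (i + 1)
      rw [h, one_mul] at h1
      apply out.not_dvd i hi
      rw [← h1]
      exact gcdSeq_succ_dvd_apply (i + 1)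
    have hR : IsUnit ((expSeq f.natDegree (degSeq G) (i + 1) : ℕ) : K[X]) :=
      isUnit_expSeq hK out i.succ_pos
    have hB : IsUnit ((expSeq f.natDegree (degSeq G) (i + 1) : ℕ) : laurentAlgebra f) :=
      isUnit_expSeq hK out i.succ_pos
    rw [keyDegree_succ] at hQN
    obtain ⟨k, hk⟩ : ∃ k, expSeq f.natDegree (degSeq G) (i + 1) = k + 1 :=
      ⟨expSeq f.natDegree (degSeq G) (i + 1) - 1, by omega⟩
    rw [hk] at hkey hR hB hQN hQd hone
    -- The root is extracted over `K[X]`, so no denominators in `f` appear; only the comparison with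
    -- `ψ` takes place over `K[f, f⁻¹]`.
    obtain ⟨A, hA, hAN, hQA⟩ := exists_approximate_root hR hQ hQN
    have hψd : (laurentEval f g ψ).intDegree = degSeq G (i + 1) := by rw [hψG, degSeq]
    have key := hkey.intDegree_approximate_root (by omega) hB (hQ.map (toLaurentAlgebra f))
      (by rw [hQ.natDegree_map, hQN])
      (by rw [laurentEval_map, hψd]; exact hQd.mono (by omega))
      (hA.map (toLaurentAlgebra f)) (by rw [hA.natDegree_map, hAN]) (by
        rw [← Polynomial.map_pow, ← Polynomial.map_sub, mem_degreeLT]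
        exact degree_map_le.trans_lt (mem_degreeLT.1 hQA))
    rw [laurentEval_map, hψd] at key
    refine ⟨A, hA, hAN, Or.inr ?_, fun _ => key⟩
    rw [key.2]
    exact (ReductionStep.degLE (out.ne_zero i (by omega)) (out.step i (by omega))).le hne

theorem exists_isKeyPolynomial (hf : 0 < f.natDegree)
    (hK : ((Nat.gcd f.natDegree g.natDegree : ℕ) : K) ≠ 0) (out : IsAlgorithmOutput f g s G)
    (hlast : gcdSeq f.natDegree (degSeq G) (s + 1) = 1) {i : ℕ} (hi : i ≤ s) :
    ∃ A : K[X][X], IsKeyPolynomial (pairEvalRat f g) (keyDegree f.natDegree (degSeq G) i)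
      (gcdSeq f.natDegree (degSeq G) i) (expSeq f.natDegree (degSeq G) i) A ∧
      (pairEvalRat f g A).intDegree = degSeq G i := by
  have hd := (out.dvdDegrees hf (show i ≤ s + 1 by omega)).pairEvalRat hf
  suffices H : ∃ A : K[X][X], A.Monic ∧ A.natDegree = keyDegree f.natDegree (degSeq G) i ∧
      pairEvalRat f g A ≠ 0 ∧ (pairEvalRat f g A).intDegree = degSeq G i by
    obtain ⟨A, hA, hAN, hA0, hAd⟩ := H
    exact ⟨A, isKeyPolynomial_of_dvdDegrees hd hA hAN hA0 hAd, hAd⟩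
  cases i with
  | zero =>
    have h1 : pairEvalRat f g X = G 0 := by rw [out.start]; simp [pairEvalRat, pairEval]
    exact ⟨X, monic_X, by simp [keyDegree], by rw [h1]; exact out.ne_zero 0 hi, by rw [h1, degSeq]⟩
  | succ i =>
    obtain ⟨A, hA, hAN, -, h⟩ := out.exists_approximate_roots hf hK hlast (i := i) (by omega)
    exact ⟨A, hA, hAN, h (by omega)⟩

/-- Every multiple of the `i`-th greatest common divisor is the degree of a polynomial in `f` and
`g` whose degree in `g` is less than that of the `i`-th member of the sequence. -/
theorem exists_intDegree_eq (hf : 0 < f.natDegree)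
    (hK : ((Nat.gcd f.natDegree g.natDegree : ℕ) : K) ≠ 0) (out : IsAlgorithmOutput f g s G)
    {u : K[X][X]} (hu : (pairEvalRat f g u).intDegree = 1) {i : ℕ} (hi : i ≤ s + 1) (x : ℕ)
    (hx : gcdSeq f.natDegree (degSeq G) i ∣ x) :
    ∃ r ∈ degreeLT K[X] (keyDegree f.natDegree (degSeq G) i), r ≠ 0 ∧
      (pairEvalRat f g r).intDegree = x := by
  have hlast := out.gcdSeq_last hf hu
  induction hi using Nat.decreasingInduction with
  | self =>
    obtain ⟨P, hP, hPN, hPg⟩ := exists_monic_pairEval_eq_zero (g := g) hf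
    have hn := keyDegree_mul_gcdSeq (n := f.natDegree) (m := degSeq G) (s + 1)
    rw [hlast, mul_one] at hn
    have hu0 : pairEvalRat f g u ≠ 0 := by
      intro h
      simp [h] at hu
    have h2 : pairEvalRat f g (u ^ x %ₘ P) = pairEvalRat f g u ^ x := by
      rw [← map_pow]
      conv_rhs => rw [← modByMonic_add_div (u ^ x) P]
      rw [map_add, map_mul, pairEvalRat, RingHom.comp_apply _ _ P, hPg, map_zero, zero_mul,
        add_zero]
    refine ⟨u ^ x %ₘ P, by rw [hn, ← hPN]; exact modByMonic_mem_degreeLT hP, ?_, ?_⟩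
    · intro h
      rw [h, map_zero] at h2
      exact pow_ne_zero x hu0 h2.symm
    · rw [h2, intDegree_pow hu0, hu, mul_one]
  | of_succ i hi ih =>
    obtain ⟨r, hr, hr0, hrx⟩ := ih ((gcdSeq_succ_dvd i).trans hx)
    obtain ⟨A, hA, hAd⟩ := out.exists_isKeyPolynomial hf hK hlast (i := i) (by omega)
    rw [keyDegree_succ] at hr
    obtain ⟨-, j, hj, v, hv, hv0, h⟩ := hA.expansion le_rfl hr hr0
    -- The total degree and that of `v` are divisible by `gcdSeq i`, hence so is the contribution of
    -- the power of `A`; this forces exponent zero, so `v` already has the required degree.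
    have hj0 : j = 0 := by
      by_contra hj0
      refine hA.not_dvd j (by omega) hj ?_
      have h1 : (j : ℤ) * (pairEvalRat f g A).intDegree = x - (pairEvalRat f g v).intDegree := by
        rw [← hrx, h]; ring
      rw [h1]
      exact dvd_sub (by exact_mod_cast hx) (hA.dvdDegrees v hv hv0).2
    refine ⟨v, hv, hv0, ?_⟩
    rw [← hrx, h, hj0]
    simp

/-- Expand an element of degree `dᵢ` in powers of a key polynomial whose value has degree `mᵢ`. All
degrees involved are nonnegative because the values lie in `K[z]`. -/
theorem degSeq_eq_gcdSeq_or_dvd (hf : 0 < f.natDegree)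
    (hK : ((Nat.gcd f.natDegree g.natDegree : ℕ) : K) ≠ 0) (out : IsAlgorithmOutput f g s G)
    {u : K[X][X]} (hu : (pairEvalRat f g u).intDegree = 1) {i : ℕ} (hi : i ≤ s) :
    degSeq G i = gcdSeq f.natDegree (degSeq G) (i + 1) ∨
      (gcdSeq f.natDegree (degSeq G) i : ℤ) ∣ degSeq G i := by
  obtain ⟨r, hr, hr0, hrx⟩ := out.exists_intDegree_eq hf hK hu (i := i + 1) (by omega) _ dvd_rfl
  obtain ⟨A, hA, hAd⟩ := out.exists_isKeyPolynomial hf hK (out.gcdSeq_last hf hu) hi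
  rw [keyDegree_succ] at hr
  obtain ⟨-, j, hj, v, hv, hv0, h⟩ := hA.expansion le_rfl hr hr0
  rw [hrx, hAd] at h
  have hv1 := intDegree_pairEvalRat_nonneg (f := f) (g := g) v
  have hA1 := intDegree_pairEvalRat_nonneg (f := f) (g := g) A
  rw [hAd] at hA1
  have hdvd := gcdSeq_succ_dvd_apply (n := f.natDegree) (m := degSeq G) i
  rcases Nat.eq_zero_or_pos j with rfl | hj0
  · right
    refine dvd_trans ?_ hdvd
    rw [h]
    simpa using (hA.dvdDegrees v hv hv0).2
  rcases hA1.eq_or_lt with h0 | hpos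
  · right
    rw [← h0]
    exact dvd_zero _
  · left
    -- The chain `dᵢ ≤ mᵢ ≤ j mᵢ ≤ dᵢ` collapses to equalities.
    have h1 := Int.le_of_dvd hpos hdvd
    have h2 : degSeq G i ≤ j * degSeq G i :=
      le_mul_of_one_le_left hpos.le (by exact_mod_cast hj0)
    omega

end IsAlgorithmOutput

end Output

/-! ### The main theorem. -/

theorem mainTheorem7 {K : Type*} [Field K] (f g : K[X])
    (hf : 0 < f.natDegree) (hg : g ≠ 0)
    (hK : ((Nat.gcd f.natDegree g.natDegree : ℕ) : K) ≠ 0)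
    (h_one : 1 ∈ degreeSemigroup f g) :
    (∃ (s : ℕ) (G : ℕ → RatFunc K), IsAlgorithmOutput f g s G) ∧
    ∀ (s : ℕ) (G : ℕ → RatFunc K), IsAlgorithmOutput f g s G →
      (∀ i < s, degSeq G (i + 1) ≠ 0 ∧ degSeq G (i + 1) ∣ degSeq G i) ∧
      ((f.natDegree : ℤ) ∣ degSeq G 0 ∨ degSeq G 0 ∣ (f.natDegree : ℤ)) := by
  obtain ⟨h, hh, -, hdeg⟩ := h_one
  obtain ⟨u, rfl⟩ := exists_pairEval_eq hh
  have hu : (pairEvalRat f g u).intDegree = 1 := by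
    rw [pairEvalRat, RingHom.comp_apply, RatFunc.intDegree_polynomial, hdeg, Nat.cast_one]
  constructor
  · refine exists_algorithmOutput_of_steps (t := 0) (G := fun _ => algebraMap K[X] (RatFunc K) g)
      hf (u := u.map (toLaurentAlgebra f)) (by rw [laurentEval_map, hu]) rfl ?_ ?_ ?_
    · intro i _
      simpa using hg
    · intro i hi
      omega
    · intro i hi
      omega
  · intro s G out
    refine ⟨fun i hi => ?_, ?_⟩
    · have h1 := (out.degSeq_eq_gcdSeq_or_dvd hf hK hu (i := i + 1) hi).resolve_right
        (out.not_dvd i hi)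
      rw [h1]
      refine ⟨by exact_mod_cast (gcdSeq_pos hf _).ne',
        dvd_trans ?_ (gcdSeq_succ_dvd_apply (n := f.natDegree) i)⟩
      exact_mod_cast gcdSeq_succ_dvd (i + 1)
    · rcases out.degSeq_eq_gcdSeq_or_dvd hf hK hu (Nat.zero_le s) with h1 | h1
      · right
        rw [h1]
        exact_mod_cast gcdSeq_dvd_of_le (Nat.zero_le 1)
      · exact Or.inl h1
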